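/- Let $T>0$, $\beta>0$, let $\Omega\subset\mathbb R^d$ be open, convex and bounded, and let $\omega$ be open with $\overline\omega\subset\Omega$. Let $B\in\mathbb R^{d\times M}$, $f\in C([0,T];C^1(\overline\Omega;\mathbb R^d))$, and let $\ell\in C([0,T];C^1(\overline\Omega))$, $g\in C^1(\overline\Omega)$ be nonnegative. For $v\in X:=C([0,T];C^2(\overline\Omega))$ put $$U_v(t,y)=-\tfrac1\beta B^\top\nabla_y v(t,y),\qquad F_v(t,y)=f(t,y)+BU_v(t,y),\qquad (t,y)\in[0,T]\times\overline\Omega .$$ For $t_0\in[0,T]$ and $y_0\in\omega$ let $y=y(\cdot\,;t_0,y_0,v)$ denote the $\overline\Omega$-valued solution (if it exists; it is then unique) of $$y'(t)=F_v(t,y(t))\ \ (t\in[t_0,T]),\qquad y(t_0)=y_0 .$$ Let $\mathcal D\subset X$ be the set of all $v$ for which this solution exists for every $(t_0,y_0)\in[0,T]\times\omega$ and for which the closure of $$\mathcal R(v)=\{y(t;t_0,y_0,v):\ t_0\in(0,T),\ y_0\in\omega,\ t\in[t_0,T)\}$$ is contained in $\Omega$. For $v\in\mathcal D$ define the closed-loop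 cost $$\mathcal V(t_0,y_0,v)=\int_{t_0}^T\Big(\ell(t,y(t))+\tfrac\beta2|U_v(t,y(t))|^2\Big)dt+g(y(T)).$$ **Proposition.** $\mathcal V$ is continuously (Fréchet) differentiable on $(0,T)\times\omega\times\mathcal D$, as a function on a subset of $\mathbb R\times\mathbb R^d\times X$. Moreover, let $v\in\mathcal D$, $(t_0,y_0)\in(0,T)\times\omega$ and $y=y(\cdot\,;t_0,y_0,v)$. Then the adjoint equation $$-p'(t)-D_yF_v(t,y(t))^\top p(t)=-\nabla_y\ell(t,y(t))-\beta\,D_yU_v(t,y(t))^\top U_v(t,y(t))\ \ (t\in[t_0,T]),\qquad p(T)=-\nabla g(y(T)),$$ has exactly one solution $p\in C^1([t_0,T];\mathbb R^d)$, and $$\nabla_{y_0}\mathcal V(t_0,y_0,v)=-p(t_0),$$ $$\frac{\partial\mathcal V}{\partial t_0}(t_0,y_0,v)=-\ell(t_0,y_0)-\tfrac\beta2|U_v(t_0,y_0)|^2+p(t_0)^\top\big(f(t_0,y_0)+BU_v(t_0,y_0)\big).$$ Finally, the partial derivative $D_v\mathcal V(t_0,y_0,v)$, a bounded linear functional on $X$,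 has exactly one extension to a bounded linear functional on $C([0,T];C^1(\overline\Omega))$, and this extension (denoted by the same symbol) satisfies, for all $\phi\in C([0,T];C^1(\overline\Omega))$, $$D_v\mathcal V(t_0,y_0,v)\cdot\phi=\frac1\beta\int_{t_0}^T\nabla_y\phi(t,y(t))^\top BB^\top\big(\nabla_yv(t,y(t))+p(t)\big)\,dt .$$ -/

import Mathlib

open Set Topology

noncomputable section

namespace FeedbackLearning

/-- Extension by zero of a map defined on a subset. It is only ever evaluated on the subset, or
differentiated at interior points of the subset. -/
def zeroExt {α Z : Type*} [Zero Z] {S : Set α} (u : S → Z) (x : α) : Z :=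
  open Classical in if h : x ∈ S then u ⟨x, h⟩ else 0

theorem zeroExt_add {α Z : Type*} [AddMonoid Z] {S : Set α} (u w : S → Z) :
    zeroExt (fun s => u s + w s) = zeroExt u + zeroExt w := by
  funext x
  by_cases h : x ∈ S <;> simp [zeroExt, h]

theorem zeroExt_smul {α Z : Type*} [AddMonoid Z] [DistribMulAction ℝ Z] {S : Set α}
    (c : ℝ) (u : S → Z) :
    zeroExt (fun s => c • u s) = c • zeroExt u := by
  funext x
  by_cases h : x ∈ S <;> simp [zeroExt, h]

theorem zeroExt_zero {α Z : Type*} [Zero Z] {S : Set α} :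
    zeroExt (fun _ : S => (0 : Z)) = 0 := by
  funext x
  by_cases h : x ∈ S <;> simp [zeroExt, h]

/-- `ℝⁿ` with the Euclidean norm. -/
abbrev Euc (n : ℕ) : Type := EuclideanSpace ℝ (Fin n)

section Spaces

open scoped BoundedContinuousFunction

/-- Pairs `(u, u')` of bounded continuous functions on `Ω̄`, with the maximum norm. -/
def Jet {d : ℕ} (Ω : Set (Euc d)) (F : Type*) [NormedAddCommGroup F] [NormedSpace ℝ F] :
    Type _ := (closure Ω →ᵇ F) × (closure Ω →ᵇ (Euc d →L[ℝ] F))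

section Jets

variable {d : ℕ} (Ω : Set (Euc d)) (F : Type*) [NormedAddCommGroup F] [NormedSpace ℝ F]

instance : NormedAddCommGroup (Jet Ω F) :=
  inferInstanceAs (NormedAddCommGroup ((closure Ω →ᵇ F) × (closure Ω →ᵇ (Euc d →L[ℝ] F))))

instance : NormedSpace ℝ (Jet Ω F) :=
  inferInstanceAs (NormedSpace ℝ ((closure Ω →ᵇ F) × (closure Ω →ᵇ (Euc d →L[ℝ] F))))

end Jets

/-- The space `C¹(Ω̄; F)` for an open set `Ω`: the bounded continuous `u` on `Ω̄` that are
differentiable in `Ω` with a derivative that extends to a bounded continuous function on `Ω̄`.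
An element is recorded as the pair `(u, Du)` (the second entry is determined by the first, since
`Ω` is dense in its closure); the norm is `max (sup ‖u‖) (sup ‖Du‖)`. -/
def C1Sub {d : ℕ} (Ω : Set (Euc d)) (F : Type*) [NormedAddCommGroup F] [NormedSpace ℝ F] :
    Submodule ℝ (Jet Ω F) where
  carrier := {q | ∀ x (hx : x ∈ Ω), HasFDerivAt (zeroExt q.1) (q.2 ⟨x, subset_closure hx⟩) x}
  add_mem' := by
    intro a b ha hb x hx
    have h := (ha x hx).add (hb x hx)
    rw [← zeroExt_add] at h
    exact h
  zero_mem' := by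
    intro x hx
    have h : HasFDerivAt (0 : Euc d → F) (0 : Euc d →L[ℝ] F) x := hasFDerivAt_zero x
    rw [← zeroExt_zero (S := closure Ω)] at h
    exact h
  smul_mem' := by
    intro c a ha x hx
    have h := (ha x hx).const_smul c
    rw [← zeroExt_smul] at h
    exact h

/-- `C¹(Ω̄; F)` as a normed space. -/
abbrev C1 {d : ℕ} (Ω : Set (Euc d)) (F : Type*) [NormedAddCommGroup F] [NormedSpace ℝ F] :
    Type _ := C1Sub Ω F

/-- The function on `Ω̄` underlying an element of `C¹(Ω̄; F)`. -/
def fn {d : ℕ} {Ω : Set (Euc d)} {F : Type*} [NormedAddCommGroup F] [NormedSpace ℝ F]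
    (u : C1 Ω F) : closure Ω →ᵇ F := u.1.1

/-- The derivative, continuously extended to `Ω̄`, of an element of `C¹(Ω̄; F)`. -/
def der {d : ℕ} {Ω : Set (Euc d)} {F : Type*} [NormedAddCommGroup F] [NormedSpace ℝ F]
    (u : C1 Ω F) : closure Ω →ᵇ (Euc d →L[ℝ] F) := u.1.2

/-- The space `C²(Ω̄)` of real functions: those `u ∈ C¹(Ω̄)` with `Du ∈ C¹(Ω̄; (ℝᵈ)*)`. An element
is recorded as the pair `(u, Du)`, so that the norm is `max (sup |u|) (sup ‖Du‖) (sup ‖D²u‖)`. -/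
def C2Sub {d : ℕ} (Ω : Set (Euc d)) : Submodule ℝ (C1 Ω ℝ × C1 Ω (Euc d →L[ℝ] ℝ)) where
  carrier := {q | der q.1 = fn q.2}
  add_mem' {a _} ha hb := congrArg₂ (· + ·) (show der a.1 = fn a.2 from ha) hb
  zero_mem' := rfl
  smul_mem' c a ha := congrArg (fun w : closure Ω →ᵇ (Euc d →L[ℝ] ℝ) => c • w)
    (show der a.1 = fn a.2 from ha)

/-- `C²(Ω̄)` as a normed space. -/
abbrev C2 {d : ℕ} (Ω : Set (Euc d)) : Type := C2Sub Ω

/-- The inclusion `C²(Ω̄) ⊂ C¹(Ω̄)`, which forgets the second derivative. -/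
def C2.toC1 {d : ℕ} (Ω : Set (Euc d)) : C2 Ω →L[ℝ] C1 Ω ℝ :=
  (ContinuousLinearMap.fst ℝ (C1 Ω ℝ) (C1 Ω (Euc d →L[ℝ] ℝ))).comp (C2Sub Ω).subtypeL

end Spaces

/-- `C([0,T]; C¹(Ω̄; F))` with the supremum norm in time. -/
abbrev CtC1 {d : ℕ} (T : ℝ) (Ω : Set (Euc d)) (F : Type*) [NormedAddCommGroup F]
    [NormedSpace ℝ F] : Type _ := C(Icc (0 : ℝ) T, C1 Ω F)

/-- `C([0,T]; C²(Ω̄))` with the supremum norm in time. -/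
abbrev CtC2 {d : ℕ} (T : ℝ) (Ω : Set (Euc d)) : Type := C(Icc (0 : ℝ) T, C2 Ω)

/-- The inclusion `C([0,T]; C²(Ω̄)) ⊂ C([0,T]; C¹(Ω̄))`. -/
def incl {d : ℕ} (T : ℝ) (Ω : Set (Euc d)) : CtC2 T Ω →L[ℝ] CtC1 T Ω ℝ :=
  (C2.toC1 Ω).compLeftContinuous ℝ (Icc (0 : ℝ) T)

/-- The value `φ(t, x)`, for `t ∈ [0,T]` and `x ∈ Ω̄`. -/
def val {d : ℕ} {T : ℝ} {Ω : Set (Euc d)} {F : Type*} [NormedAddCommGroup F] [NormedSpace ℝ F]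
    (φ : CtC1 T Ω F) (t : ℝ) (x : Euc d) : F :=
  zeroExt (fn (zeroExt φ t)) x

/-- The spatial gradient `∇_y φ(t, x)`, for `t ∈ [0,T]` and `x ∈ Ω̄` (on the boundary of `Ω` it is
the continuous extension of the gradient in `Ω`). -/
def grad {d : ℕ} {T : ℝ} {Ω : Set (Euc d)} (φ : CtC1 T Ω ℝ) (t : ℝ) (x : Euc d) : Euc d :=
  (InnerProductSpace.toDual ℝ (Euc d)).symm (zeroExt (der (zeroExt φ t)) x)

/-- The data of the control problem: minimise
`∫_{t₀}^T (ℓ(t,y) + β/2 |u|²) dt + g(y(T))` subject to `y' = f(t,y) + B u`, `y(t₀) = y₀`,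
together with the set `ω` of initial values. -/
structure ControlProblem (d M : ℕ) where
  T : ℝ
  T_pos : 0 < T
  β : ℝ
  β_pos : 0 < β
  Ω : Set (Euc d)
  isOpen_Ω : IsOpen Ω
  convex_Ω : Convex ℝ Ω
  isBounded_Ω : Bornology.IsBounded Ω
  ω : Set (Euc d)
  isOpen_ω : IsOpen ω
  closure_ω_subset : closure ω ⊆ Ω
  B : Matrix (Fin d) (Fin M) ℝ
  f : CtC1 T Ω (Euc d)
  ℓ : CtC1 T Ω ℝ
  ℓ_nonneg : ∀ t x, 0 ≤ fn (ℓ t) x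
  g : C1 Ω ℝ
  g_nonneg : ∀ x, 0 ≤ fn g x

namespace ControlProblem

variable {d M : ℕ} (P : ControlProblem d M)

/-- The matrix `B` as a linear map; its transpose is the adjoint `P.Bop.adjoint`. -/
def Bop : Euc M →L[ℝ] Euc d := (Matrix.toEuclideanLin P.B).toContinuousLinearMap

/-- The terminal cost `g(x)`, for `x ∈ Ω̄`. -/
def terminalCost (x : Euc d) : ℝ := zeroExt (fn P.g) x

/-- The feedback `U_v(t,x) = -(1/β) Bᵀ ∇_y v(t,x)`. -/
def U (v : CtC2 P.T P.Ω) (t : ℝ) (x : Euc d) : Euc M :=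
  -(1 / P.β) • P.Bop.adjoint (grad (incl P.T P.Ω v) t x)

/-- The closed-loop vector field `F_v(t,x) = f(t,x) + B U_v(t,x)`. -/
def F (v : CtC2 P.T P.Ω) (t : ℝ) (x : Euc d) : Euc d :=
  val P.f t x + P.Bop (P.U v t x)

/-- `y` solves the closed-loop problem `y' = F_v(t,y)` on `[t₀,T]`, `y(t₀) = y₀`, with values in the
set `Ω̄` on which `F_v` is defined. -/
def IsTrajectory (v : CtC2 P.T P.Ω) (t₀ : ℝ) (y₀ : Euc d) (y : ℝ → Euc d) : Prop :=
  y t₀ = y₀ ∧ ∀ t ∈ Icc t₀ P.T, y t ∈ closure P.Ω ∧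
    HasDerivWithinAt y (P.F v t (y t)) (Icc t₀ P.T) t

/-- The solution map `Φ(t₀,y₀,v)`: the closed-loop trajectory on `[t₀,T]`, extended to `[0,t₀]` by
`y₀ + ∫_{t₀}^t F_v(s,y₀) ds`. -/
def Φ (t₀ : ℝ) (y₀ : Euc d) (v : CtC2 P.T P.Ω) (t : ℝ) : Euc d :=
  open Classical in
  if h : ∃ y, P.IsTrajectory v t₀ y₀ y then
    if t₀ ≤ t then h.choose t else y₀ + ∫ s in t₀..t, P.F v s y₀
  else 0

/-- The set `𝒢(v)` of all points `(t, y(t; t₀, y₀))` of the closed-loop trajectories. -/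
def G (v : CtC2 P.T P.Ω) : Set (ℝ × Euc d) :=
  {q | ∃ t₀ ∈ Ioo 0 P.T, ∃ y₀ ∈ P.ω, q.1 ∈ Ico t₀ P.T ∧ q.2 = P.Φ t₀ y₀ v q.1}

/-- The set `ℛ(v)` of all states that are visited. -/
def R (v : CtC2 P.T P.Ω) : Set (Euc d) :=
  {x | ∃ t ∈ Ioo 0 P.T, (t, x) ∈ P.G v}

/-- The set `𝒟` of admissible `v`. -/
def D : Set (CtC2 P.T P.Ω) :=
  {v | (∀ t₀ ∈ Icc 0 P.T, ∀ y₀ ∈ P.ω, ∃ y, P.IsTrajectory v t₀ y₀ y) ∧ closure (P.R v) ⊆ P.Ω}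

/-- The closed-loop cost `𝒱(t₀,y₀,v)`. -/
def V (t₀ : ℝ) (y₀ : Euc d) (v : CtC2 P.T P.Ω) : ℝ :=
  (∫ t in t₀..P.T, (val P.ℓ t (P.Φ t₀ y₀ v t) + P.β / 2 * ‖P.U v t (P.Φ t₀ y₀ v t)‖ ^ 2))
    + P.terminalCost (P.Φ t₀ y₀ v P.T)

/-- `p ∈ C¹([t₀,T]; ℝᵈ)` solves the adjoint equation along `y = Φ(t₀,y₀,v)`:
`-p' - (D_y F_v)ᵀ p = -∇_y ℓ - β (D_y U_v)ᵀ U_v` on `[t₀,T]`, and `p(T) = -∇g(y(T))`. -/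
def IsAdjointState (t₀ : ℝ) (y₀ : Euc d) (v : CtC2 P.T P.Ω) (p : ℝ → Euc d) : Prop :=
  ContDiffOn ℝ 1 p (Icc t₀ P.T) ∧
  (∀ t ∈ Icc t₀ P.T,
    -derivWithin p (Icc t₀ P.T) t - (fderiv ℝ (P.F v t) (P.Φ t₀ y₀ v t)).adjoint (p t) =
      -gradient (val P.ℓ t) (P.Φ t₀ y₀ v t)
        - P.β • (fderiv ℝ (P.U v t) (P.Φ t₀ y₀ v t)).adjoint (P.U v t (P.Φ t₀ y₀ v t))) ∧
  p P.T = -gradient P.terminalCost (P.Φ t₀ y₀ v P.T)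

end ControlProblem

end FeedbackLearning

end

/-! The cost is shown to be strictly differentiable at every point of `(0,T) × ω × 𝒟`. Strict
differentiability at the points of a set makes the derivative continuous on that set
(`continuousOn_fderiv_of_hasStrictFDerivAt`), and no openness of `𝒟` is needed.

The flow itself is never differentiated; Lipschitz dependence of the trajectories on `(t₀, y₀, v)`
is enough. Composing the closed-loop field with the nearest-point map onto `Ω̄` makes it bounded and
globally Lipschitz, so a flow exists on all of `[0,T]`, and Grönwall gives the Lipschitz estimate
(`exists_isFlow`). For `v ∈ 𝒟` the trajectory is a compact curve in `Ω`. It can be continued a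
little before `t₀`, and all nearby curves of the flow also stay in `Ω`, where they are genuine
trajectories.

Let `e` be the difference of two nearby trajectories. Up to errors uniformly small in time, the
increment of the running cost is `⟨b, e⟩ + c δv`, and that of the velocity is `e' = A e + C δv`. If
`p' = b - A* p`, then `⟨p, e⟩' = ⟨b, e⟩ + ⟨p, e' - A e⟩` (`integral_inner_adjoint_eq`). So the cost
increment reduces to boundary terms and `∫ (c - ⟨p, C ·⟩) δv`. The terminal condition on `p` cancels
the increment of `g`. The remaining term `-⟨p(s), e(s)⟩` and the running cost over the shifted
initial time give the derivatives in `y₀` and `t₀` (`hasStrictFDerivAt_cost`).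

Since `U_v` is linear in `∇v`, the parameter integral is the stated formula (`inner_feedback_eq`).
It involves `φ` only through `∇φ`, hence is bounded in the `C¹` norm (`exists_gradient_functional`).
The extension is unique because `C²` is dense in `C¹`: contract `Ω̄` into `Ω`, cut off, mollify, and
glue in time by a partition of unity (`denseRange_incl`). -/

noncomputable section

namespace FeedbackLearning

/-! ### Ordinary differential equations: Grönwall, global existence, nearest-point maps. -/

section ODE

open scoped NNReal

/-- Grönwall's inequality on an interval, forward and backward in time. -/
theorem norm_le_of_norm_deriv_le {E : Type*} [NormedAddCommGroup E] [NormedSpace ℝ E]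
    {e e' : ℝ → E} {a b K ε : ℝ} (hK : 0 ≤ K) (hε : 0 ≤ ε)
    (he : ∀ t ∈ Icc a b, HasDerivWithinAt e (e' t) (Icc a b) t)
    (bound : ∀ t ∈ Icc a b, ‖e' t‖ ≤ K * ‖e t‖ + ε) {s t : ℝ} (hs : s ∈ Icc a b)
    (ht : t ∈ Icc a b) :
    ‖e t‖ ≤ (‖e s‖ + ε) * Real.exp ((K + 1) * (b - a)) := by
  -- The rate `K + 1` is nonzero even for `K = 0`, so `gronwallBound` has its exponential form; it
  -- also gives `ε / (K + 1) ≤ ε`.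
  have key : ∀ L ∈ Icc 0 (b - a),
      gronwallBound ‖e s‖ (K + 1) ε L ≤ (‖e s‖ + ε) * Real.exp ((K + 1) * (b - a)) := by
    intro L hL
    rw [gronwallBound_of_K_ne_0 (by positivity)]
    have h1 : Real.exp ((K + 1) * L) ≤ Real.exp ((K + 1) * (b - a)) := by
      have := hL.2
      gcongr
    have h2 : ε / (K + 1) ≤ ε := div_le_self hε (by linarith)
    have h3 : 1 ≤ Real.exp ((K + 1) * L) := Real.one_le_exp (mul_nonneg (by positivity) hL.1)
    calc ‖e s‖ * Real.exp ((K + 1) * L) + ε / (K + 1) * (Real.exp ((K + 1) * L) - 1)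
        ≤ ‖e s‖ * Real.exp ((K + 1) * L) + ε * Real.exp ((K + 1) * L) := by
          gcongr
          linarith
      _ = (‖e s‖ + ε) * Real.exp ((K + 1) * L) := by ring
      _ ≤ _ := by gcongr
  have bound' : ∀ t ∈ Icc a b, ‖e' t‖ ≤ (K + 1) * ‖e t‖ + ε := fun t ht =>
    (bound t ht).trans (by nlinarith [norm_nonneg (e t)])
  rcases le_total s t with hst | hst
  · refine (norm_le_gronwallBound_of_norm_deriv_right_le (f := e) (f' := e') (a := s) (b := b)
      (δ := ‖e s‖) (K := K + 1) (ε := ε) ?_ ?_ le_rfl ?_ t ⟨hst, ht.2⟩).trans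
      (key _ ⟨by linarith, by linarith [hs.1, ht.2]⟩)
    · exact fun x hx => ((he x ⟨hs.1.trans hx.1, hx.2⟩).continuousWithinAt).mono
        (Icc_subset_Icc_left hs.1)
    · intro x hx
      have hx' : x ∈ Ico a b := ⟨hs.1.trans hx.1, hx.2⟩
      refine ((he x ⟨hx'.1, hx.2.le⟩).mono_of_mem_nhdsWithin ?_)
      exact Icc_mem_nhdsGE_of_mem hx'
    · exact fun x hx => bound' x ⟨hs.1.trans hx.1, hx.2.le⟩
  -- Backward in time: the forward inequality is applied to the reflected curve `x ↦ e (-x)`.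
  · have hmem : ∀ x ∈ Icc (-s) (-a), -x ∈ Icc a b := fun x hx =>
      ⟨by linarith [hx.2], by linarith [hx.1, hs.2]⟩
    have hd : ∀ x ∈ Icc (-s) (-a),
        HasDerivWithinAt (fun x => e (-x)) (-e' (-x)) (Icc (-b) (-a)) x := by
      intro x hx
      have h := (he (-x) (hmem x hx)).scomp x (hasDerivAt_neg x).hasDerivWithinAt
        (s := Icc (-b) (-a)) (fun u hu => ⟨by linarith [hu.2], by linarith [hu.1]⟩)
      simpa [Function.comp_def] using h
    have hsb : -b ≤ -s := by linarith [hs.2]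
    have h := norm_le_gronwallBound_of_norm_deriv_right_le (f := fun x => e (-x))
      (f' := fun x => -e' (-x)) (a := -s) (b := -a)
      (δ := ‖e s‖) (K := K + 1) (ε := ε) ?_ ?_ (by simp) ?_ (-t)
      ⟨by linarith, by linarith [ht.1]⟩
    · rw [neg_neg] at h
      exact h.trans (key _ ⟨by linarith, by linarith [hs.2, ht.1]⟩)
    · exact fun x hx => ((hd x hx).continuousWithinAt).mono (Icc_subset_Icc_left hsb)
    · intro x hx
      refine (hd x ⟨hx.1, hx.2.le⟩).mono_of_mem_nhdsWithin ?_
      exact Icc_mem_nhdsGE_of_mem ⟨hsb.trans hx.1, hx.2⟩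
    · intro x hx
      simpa using bound' (-x) (hmem x ⟨hx.1, hx.2.le⟩)

/-- A bounded Lipschitz vector field has integral curves on every time interval. -/
theorem exists_hasDerivWithinAt_of_bounded {E : Type*} [NormedAddCommGroup E] [NormedSpace ℝ E]
    [CompleteSpace E] {a b : ℝ} {F : ℝ → E → E} {K : ℝ≥0} {M : ℝ}
    (hlip : ∀ t ∈ Icc a b, LipschitzWith K (F t))
    (hcont : ∀ x, ContinuousOn (fun t => F t x) (Icc a b))
    (hM : ∀ t ∈ Icc a b, ∀ x, ‖F t x‖ ≤ M) {s : ℝ} (hs : s ∈ Icc a b) (x : E) :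
    ∃ y : ℝ → E, y s = x ∧ ∀ t ∈ Icc a b, HasDerivWithinAt y (F t (y t)) (Icc a b) t := by
  have h0 : 0 ≤ max (b - s) (s - a) := le_max_of_le_left (by linarith [hs.2])
  -- The bounds on `F` are global, so the ball may have radius `M` times the longest time to travel,
  -- and Picard–Lindelöf covers the whole interval at once.
  have h : IsPicardLindelof F (tmin := a) (tmax := b) ⟨s, hs⟩ x
      (M.toNNReal * (max (b - s) (s - a)).toNNReal) 0 M.toNNReal K :=
    { lipschitzOnWith := fun t ht => (hlip t ht).lipschitzOnWith
      continuousOn := fun x _ => hcont x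
      norm_le := fun t ht x _ => (hM t ht x).trans (Real.le_coe_toNNReal M)
      mul_max_le := by
        simp [Real.coe_toNNReal _ h0] }
  exact h.exists_eq_forall_mem_Icc_hasDerivWithinAt₀

/-- The nearest point map onto a closed convex set. -/
theorem exists_nonexpansive_retraction {E : Type*} [NormedAddCommGroup E] [InnerProductSpace ℝ E]
    [CompleteSpace E] {K : Set E} (hne : K.Nonempty) (hcl : IsClosed K) (hconv : Convex ℝ K) :
    ∃ π : E → E, LipschitzWith 1 π ∧ (∀ x, π x ∈ K) ∧ ∀ x ∈ K, π x = x := by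
  choose π hπ hmin using exists_norm_eq_iInf_of_complete_convex hne hcl.isComplete hconv
  have hvar : ∀ u, ∀ w ∈ K, inner ℝ (u - π u) (w - π u) ≤ 0 := fun u =>
    (norm_eq_iInf_iff_real_inner_le_zero hconv (hπ u)).1 (hmin u)
  refine ⟨π, LipschitzWith.of_dist_le_mul fun u w => ?_, hπ, fun x hx => ?_⟩
  · have h1 := hvar u (π w) (hπ w)
    have h2 := hvar w (π u) (hπ u)
    -- The sum of the variational inequalities at the two projections; Cauchy–Schwarz then finishes.
    have h3 : inner ℝ (π u - π w) (π u - π w) ≤ inner ℝ (u - w) (π u - π w) := by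
      have : inner ℝ (u - w) (π u - π w) - inner ℝ (π u - π w) (π u - π w)
          = -inner ℝ (u - π u) (π w - π u) - inner ℝ (w - π w) (π u - π w) := by
        rw [← neg_sub (π u) (π w), inner_neg_right, neg_neg, ← inner_sub_left, ← inner_sub_left]
        congr 1
        abel
      linarith
    rw [real_inner_self_eq_norm_sq] at h3
    have h4 := h3.trans (real_inner_le_norm _ _)
    rw [dist_eq_norm, dist_eq_norm, NNReal.coe_one, one_mul]
    by_contra! hlt
    nlinarith [norm_nonneg (u - w)]
  · have h := hvar x x hx
    rw [real_inner_self_eq_norm_sq] at h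
    have : ‖x - π x‖ = 0 := by nlinarith [norm_nonneg (x - π x)]
    exact (sub_eq_zero.1 (norm_eq_zero.1 this)).symm

/-- Linear differential equations are solvable on the whole interval. -/
theorem exists_hasDerivWithinAt_linear {E : Type*} [NormedAddCommGroup E] [InnerProductSpace ℝ E]
    [CompleteSpace E] {a b : ℝ} {A : ℝ → E →L[ℝ] E} {c : ℝ → E}
    (hA : ContinuousOn A (Icc a b)) (hc : ContinuousOn c (Icc a b)) {s : ℝ} (hs : s ∈ Icc a b)
    (x : E) :
    ∃ p : ℝ → E, p s = x ∧ ∀ t ∈ Icc a b, HasDerivWithinAt p (A t (p t) + c t) (Icc a b) t := by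
  obtain ⟨K, hK⟩ := isCompact_Icc.exists_bound_of_continuousOn hA
  obtain ⟨m, hm⟩ := isCompact_Icc.exists_bound_of_continuousOn hc
  have hK0 : 0 ≤ K := (norm_nonneg _).trans (hK s hs)
  have hm0 : 0 ≤ m := (norm_nonneg _).trans (hm s hs)
  -- `R` is the a priori Grönwall bound. Projecting onto the ball of radius `R` makes the field
  -- bounded, and the solution of the truncated equation never leaves that ball.
  set R : ℝ := (‖x‖ + m) * Real.exp ((K + 1) * (b - a)) with hR
  have hR0 : 0 ≤ R := by positivity
  obtain ⟨π, hlip, hmem, hid⟩ := exists_nonexpansive_retraction (E := E)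
    (Metric.nonempty_closedBall.2 hR0) Metric.isClosed_closedBall (convex_closedBall 0 R)
  have hπ0 : ∀ u, ‖π u‖ ≤ ‖u‖ := fun u => by
    have h := hlip.dist_le_mul u 0
    rw [hid 0 (Metric.mem_closedBall_self hR0)] at h
    simpa using h
  have h1 : ∀ t ∈ Icc a b, LipschitzWith K.toNNReal fun u => A t (π u) + c t := by
    intro t ht
    refine LipschitzWith.of_dist_le_mul fun u w => ?_
    rw [dist_add_right, dist_eq_norm, ← map_sub, Real.coe_toNNReal _ hK0]
    refine (ContinuousLinearMap.le_of_opNorm_le _ (hK t ht) _).trans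
      (mul_le_mul_of_nonneg_left ?_ hK0)
    simpa [dist_eq_norm] using hlip.dist_le_mul u w
  have h2 : ∀ u, ContinuousOn (fun t => A t (π u) + c t) (Icc a b) :=
    fun u => (hA.clm_apply continuousOn_const).add hc
  have h3 : ∀ t ∈ Icc a b, ∀ u, ‖A t (π u) + c t‖ ≤ K * R + m := by
    intro t ht u
    refine (norm_add_le _ _).trans (add_le_add ?_ (hm t ht))
    refine (ContinuousLinearMap.le_of_opNorm_le _ (hK t ht) _).trans
      (mul_le_mul_of_nonneg_left ?_ hK0)
    simpa using hmem u
  obtain ⟨p, hps, hp⟩ := exists_hasDerivWithinAt_of_bounded h1 h2 h3 hs x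
  have hbound : ∀ t ∈ Icc a b, ‖A t (π (p t)) + c t‖ ≤ K * ‖p t‖ + m := by
    intro t ht
    refine (norm_add_le _ _).trans (add_le_add ?_ (hm t ht))
    exact (ContinuousLinearMap.le_of_opNorm_le _ (hK t ht) _).trans
      (mul_le_mul_of_nonneg_left (hπ0 _) hK0)
  refine ⟨p, hps, fun t ht => ?_⟩
  have hbd : ‖p t‖ ≤ R := by
    have := norm_le_of_norm_deriv_le hK0 hm0 hp hbound hs ht
    rwa [hps] at this
  have h := hp t ht
  rwa [hid (p t) (by simpa using hbd)] at h

end ODE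

/-! ### Strict differentiability of an abstract cost by duality. -/

section StrictDerivative

open Filter Asymptotics

/-- A function that is strictly differentiable at the points of a set has a continuous derivative
on this set. -/
theorem continuousOn_fderiv_of_hasStrictFDerivAt {Q W : Type*} [NormedAddCommGroup Q]
    [NormedSpace ℝ Q] [NormedAddCommGroup W] [NormedSpace ℝ W] {f : Q → W} {S : Set Q}
    (hf : ∀ q ∈ S, ∃ f' : Q →L[ℝ] W, HasStrictFDerivAt f f' q) : ContinuousOn (fderiv ℝ f) S := by
  intro q hq
  obtain ⟨f', hf'⟩ := hf q hq
  rw [Metric.continuousWithinAt_iff']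
  intro ε hε
  -- Near `q` the map `f - f'` is `ε / 2`-Lipschitz, so its derivative at nearby points has norm at
  -- most `ε / 2`.
  obtain ⟨s, hs, hlip⟩ := hf'.approximates_deriv_on_nhds (c := (ε / 2).toNNReal)
    (Or.inr (by simpa using hε))
  filter_upwards [self_mem_nhdsWithin, mem_nhdsWithin_of_mem_nhds (eventually_mem_nhds_iff.2 hs)]
    with x hxS hxs
  obtain ⟨f'', hf''⟩ := hf x hxS
  have h := (hf''.hasFDerivAt.sub f'.hasFDerivAt).le_of_lipschitzOn hxs
    hlip.lipschitzOnWith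
  rw [hf'.hasFDerivAt.fderiv, hf''.hasFDerivAt.fderiv, dist_eq_norm]
  rw [Real.coe_toNNReal _ (half_pos hε).le] at h
  linarith

/-! ### Remainders for pairs of parameters `(t₀, y₀, v)`, uniform in time. -/

section Remainders

variable {E X : Type*} [NormedAddCommGroup E] [NormedAddCommGroup X]

theorem norm_fst_sub_le (r : (ℝ × E × X) × (ℝ × E × X)) : |r.1.1 - r.2.1| ≤ ‖r.1 - r.2‖ :=
  norm_fst_le (r.1 - r.2)

theorem norm_snd_fst_sub_le (r : (ℝ × E × X) × (ℝ × E × X)) :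
    ‖r.1.2.1 - r.2.2.1‖ ≤ ‖r.1 - r.2‖ :=
  (norm_fst_le (r.1 - r.2).2).trans (norm_snd_le _)

theorem norm_snd_snd_sub_le (r : (ℝ × E × X) × (ℝ × E × X)) :
    ‖r.1.2.2 - r.2.2.2‖ ≤ ‖r.1 - r.2‖ :=
  (norm_snd_le (r.1 - r.2).2).trans (norm_snd_le _)

/-- Accounts for a shift of the initial time: on the short interval between the two times, joint
continuity keeps the integrand within `ε` of its value at the base point. -/
theorem integral_sub_smul_isLittleO {W : Type*} [NormedAddCommGroup W] [NormedSpace ℝ W]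
    [CompleteSpace W] {a T : ℝ} {q₀ : ℝ × E × X} (hq₀ : q₀.1 ∈ Ioo a T)
    {k : ℝ × E × X → ℝ → W} (hkc : ∀ᶠ q in 𝓝 q₀, ContinuousOn (k q) (Icc a T))
    (hk0 : Tendsto (fun r : (ℝ × E × X) × ℝ => k r.1 r.2) (𝓝 (q₀, q₀.1)) (𝓝 (k q₀ q₀.1))) :
    (fun r : (ℝ × E × X) × (ℝ × E × X) =>
      (∫ t in r.2.1..r.1.1, k r.2 t) - (r.1.1 - r.2.1) • k q₀ q₀.1)
      =o[𝓝 (q₀, q₀)] fun r => r.1 - r.2 := by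
  rw [isLittleO_iff]
  intro ε hε
  obtain ⟨δ, hδ, hball⟩ := Metric.eventually_nhds_iff_ball.1 (Metric.tendsto_nhds.1 hk0 ε hε)
  have h3 : ∀ᶠ q in 𝓝 q₀, q.1 ∈ Icc a T :=
    continuousAt_fst.eventually (Icc_mem_nhds hq₀.1 hq₀.2)
  have h1 : ∀ᶠ q in 𝓝 q₀, q ∈ Metric.ball q₀ δ := Metric.ball_mem_nhds _ hδ
  filter_upwards [h1.prod_inl_nhds q₀, h1.prod_inr_nhds q₀, h3.prod_inl_nhds q₀,
    h3.prod_inr_nhds q₀, hkc.prod_inr_nhds q₀] with r hr1 hr2 hr4 hr5 hr6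
  have hfst : ∀ q ∈ Metric.ball q₀ δ, q.1 ∈ Metric.ball q₀.1 δ := fun q hq => by
    rw [← ball_prod_same] at hq
    exact hq.1
  have hint : IntervalIntegrable (k r.2) MeasureTheory.volume r.2.1 r.1.1 :=
    (hr6.mono (uIcc_subset_Icc hr5 hr4)).intervalIntegrable
  rw [← intervalIntegral.integral_const, ← intervalIntegral.integral_sub hint (by simp)]
  refine (intervalIntegral.norm_integral_le_of_norm_le_const (C := ε) fun t ht => ?_).trans
    (mul_le_mul_of_nonneg_left (norm_fst_sub_le r) hε.le)
  have ht' : t ∈ Metric.ball q₀.1 δ :=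
    ((convex_ball q₀.1 δ).ordConnected.uIcc_subset (hfst _ hr2) (hfst _ hr1)) (uIoc_subset_uIcc ht)
  have := hball (r.2, t) (by rw [← ball_prod_same]; exact ⟨hr2, ht'⟩)
  rw [dist_eq_norm] at this
  exact this.le

/-- The interval shrinks while the integrand is linear in the parameter increment, so the product is
of higher order. This allows the moving lower limit in the parameter integral to be replaced by the
fixed `q₀.1`. -/
theorem integral_initial_isLittleO [NormedSpace ℝ X] {a T : ℝ} {q₀ : ℝ × E × X}
    (hq₀ : q₀.1 ∈ Ioo a T)
    {c : ℝ → X →L[ℝ] ℝ} {m : ℝ} (hm : ∀ t ∈ Icc a T, ‖c t‖ ≤ m) :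
    (fun r : (ℝ × E × X) × (ℝ × E × X) => ∫ t in r.1.1..q₀.1, c t (r.1.2.2 - r.2.2.2))
      =o[𝓝 (q₀, q₀)] fun r => r.1 - r.2 := by
  have hm0 : 0 ≤ m := (norm_nonneg _).trans (hm q₀.1 (Ioo_subset_Icc_self hq₀))
  rw [isLittleO_iff]
  intro ε hε
  have h1 : ∀ᶠ q in 𝓝 q₀, q.1 ∈ Icc a T :=
    continuousAt_fst.eventually (Icc_mem_nhds hq₀.1 hq₀.2)
  have h2 : ∀ᶠ q in 𝓝 q₀, m * |q₀.1 - q.1| < ε := by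
    have hcont : ContinuousAt (fun q : ℝ × E × X => m * |q₀.1 - q.1|) q₀ := by fun_prop
    exact hcont.eventually (gt_mem_nhds (by simpa using hε))
  filter_upwards [h1.prod_inl_nhds q₀, h2.prod_inl_nhds q₀] with r hr1 hr2
  refine (intervalIntegral.norm_integral_le_of_norm_le_const
    (C := m * ‖r.1 - r.2‖) fun t ht => ?_).trans ?_
  · have ht' : t ∈ Icc a T := uIcc_subset_Icc hr1 (Ioo_subset_Icc_self hq₀) (uIoc_subset_uIcc ht)
    exact ((c t).le_of_opNorm_le (hm t ht') _).trans
      (mul_le_mul_of_nonneg_left (norm_snd_snd_sub_le r) hm0)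
  · nlinarith [norm_nonneg (r.1 - r.2)]

/-- The expansion is used with `ε = 1`, which is the `1` in the constant. -/
theorem lipschitz_of_uniform_expansion {W : Type*} [NormedAddCommGroup W] [NormedSpace ℝ W]
    [NormedSpace ℝ E] [NormedSpace ℝ X] {q₀ : ℝ × E × X} {S : Set ℝ}
    {k : ℝ × E × X → ℝ → W} {z : ℝ × E × X → ℝ → E} {A : ℝ → E →L[ℝ] W} {C : ℝ → X →L[ℝ] W}
    {n : ℝ} (hA : ∀ t ∈ S, ‖A t‖ ≤ n) {m : ℝ} (hC : ∀ t ∈ S, ‖C t‖ ≤ m)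
    {K : ℝ} (hz : ∀ᶠ r : (ℝ × E × X) × (ℝ × E × X) in 𝓝 (q₀, q₀), ∀ t ∈ S,
      ‖z r.1 t - z r.2 t‖ ≤ K * ‖r.1 - r.2‖)
    (hk : ∀ ε > 0, ∀ᶠ r : (ℝ × E × X) × (ℝ × E × X) in 𝓝 (q₀, q₀), ∀ t ∈ S,
      ‖k r.1 t - k r.2 t - A t (z r.1 t - z r.2 t) - C t (r.1.2.2 - r.2.2.2)‖
        ≤ ε * ‖r.1 - r.2‖) :
    ∀ᶠ r : (ℝ × E × X) × (ℝ × E × X) in 𝓝 (q₀, q₀), ∀ t ∈ S,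
      ‖k r.1 t - k r.2 t‖ ≤ (n * K + m + 1) * ‖r.1 - r.2‖ := by
  filter_upwards [hk 1 one_pos, hz] with r h1 h2 t ht
  have hn0 : 0 ≤ n := (norm_nonneg _).trans (hA t ht)
  have hm0 : 0 ≤ m := (norm_nonneg _).trans (hC t ht)
  have e1 := h1 t ht
  have e2 := (A t).le_of_opNorm_le (hA t ht) (z r.1 t - z r.2 t)
  have e3 := (C t).le_of_opNorm_le (hC t ht) (r.1.2.2 - r.2.2.2)
  have e4 := mul_le_mul_of_nonneg_left (h2 t ht) hn0
  have e5 := mul_le_mul_of_nonneg_left (norm_snd_snd_sub_le r) hm0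
  have e6 : k r.1 t - k r.2 t
      = (k r.1 t - k r.2 t - A t (z r.1 t - z r.2 t) - C t (r.1.2.2 - r.2.2.2))
        + A t (z r.1 t - z r.2 t) + C t (r.1.2.2 - r.2.2.2) := by abel
  rw [e6]
  refine (norm_add₃_le).trans ?_
  linarith

theorem eventually_norm_sub_lt_of_lipschitz {Q W : Type*} [NormedAddCommGroup Q]
    [NormedAddCommGroup W] {q₀ : Q} {S : Set ℝ} {k : Q → ℝ → W} {K : ℝ}
    (hk : ∀ᶠ r : Q × Q in 𝓝 (q₀, q₀), ∀ t ∈ S, ‖k r.1 t - k r.2 t‖ ≤ K * ‖r.1 - r.2‖)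
    {η : ℝ} (hη : 0 < η) : ∀ᶠ q in 𝓝 q₀, ∀ t ∈ S, ‖k q t - k q₀ t‖ < η := by
  rw [nhds_prod_eq] at hk
  have h1 : ContinuousAt (fun q => K * ‖q - q₀‖) q₀ := by fun_prop
  have h2 : ∀ᶠ q in 𝓝 q₀, K * ‖q - q₀‖ < η := h1.eventually (gt_mem_nhds (by simpa using hη))
  filter_upwards [hk.curry, h2] with q hq hq2 t ht
  exact (hq.self_of_nhds t ht).trans_lt hq2

/-- Uniform convergence in time as `q → q₀`, combined with continuity in time at the base parameter,
gives joint continuity. -/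
theorem tendsto_of_lipschitz {W : Type*} [NormedAddCommGroup W] {a T : ℝ} {q₀ : ℝ × E × X}
    (hq₀ : q₀.1 ∈ Ioo a T) {k : ℝ × E × X → ℝ → W} {K : ℝ}
    (hkc : ContinuousOn (k q₀) (Icc a T))
    (hk : ∀ᶠ r : (ℝ × E × X) × (ℝ × E × X) in 𝓝 (q₀, q₀), ∀ t ∈ Icc a T,
      ‖k r.1 t - k r.2 t‖ ≤ K * ‖r.1 - r.2‖) :
    Tendsto (fun r : (ℝ × E × X) × ℝ => k r.1 r.2) (𝓝 (q₀, q₀.1)) (𝓝 (k q₀ q₀.1)) := by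
  have h2 : Tendsto (fun r : (ℝ × E × X) × ℝ => k r.1 r.2 - k q₀ r.2) (𝓝 (q₀, q₀.1)) (𝓝 0) := by
    rw [Metric.tendsto_nhds]
    intro η hη
    have h5 : ∀ᶠ t in 𝓝 q₀.1, t ∈ Icc a T := Icc_mem_nhds hq₀.1 hq₀.2
    filter_upwards [(eventually_norm_sub_lt_of_lipschitz hk hη).prod_inl_nhds q₀.1,
      h5.prod_inr_nhds q₀] with r hr1 hr2
    rw [dist_zero_right]
    exact hr1 r.2 hr2
  have h6 : ContinuousAt (k q₀) q₀.1 := hkc.continuousAt (Icc_mem_nhds hq₀.1 hq₀.2)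
  have h7 : Tendsto (fun r : (ℝ × E × X) × ℝ => k q₀ r.2) (𝓝 (q₀, q₀.1)) (𝓝 (k q₀ q₀.1)) :=
    h6.tendsto.comp continuousAt_snd
  simpa using h2.add h7

/-- Uniform strict differentiability of the squared norm of a uniformly strictly differentiable
family. -/
theorem uniform_expansion_norm_sq {W : Type*} [NormedAddCommGroup W] [InnerProductSpace ℝ W]
    [NormedSpace ℝ E] [NormedSpace ℝ X] {q₀ : ℝ × E × X} {S : Set ℝ}
    {k : ℝ × E × X → ℝ → W} {z : ℝ × E × X → ℝ → E} {A : ℝ → E →L[ℝ] W} {C : ℝ → X →L[ℝ] W}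
    {n : ℝ} (hA : ∀ t ∈ S, ‖A t‖ ≤ n) {m : ℝ} (hC : ∀ t ∈ S, ‖C t‖ ≤ m)
    {N : ℝ} (hN : ∀ t ∈ S, ‖k q₀ t‖ ≤ N)
    {K : ℝ} (hz : ∀ᶠ r : (ℝ × E × X) × (ℝ × E × X) in 𝓝 (q₀, q₀), ∀ t ∈ S,
      ‖z r.1 t - z r.2 t‖ ≤ K * ‖r.1 - r.2‖)
    (hk : ∀ ε > 0, ∀ᶠ r : (ℝ × E × X) × (ℝ × E × X) in 𝓝 (q₀, q₀), ∀ t ∈ S,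
      ‖k r.1 t - k r.2 t - A t (z r.1 t - z r.2 t) - C t (r.1.2.2 - r.2.2.2)‖
        ≤ ε * ‖r.1 - r.2‖) :
    ∀ ε > 0, ∀ᶠ r : (ℝ × E × X) × (ℝ × E × X) in 𝓝 (q₀, q₀), ∀ t ∈ S,
      |‖k r.1 t‖ ^ 2 - ‖k r.2 t‖ ^ 2 - 2 * inner ℝ (k q₀ t) (A t (z r.1 t - z r.2 t))
        - 2 * inner ℝ (k q₀ t) (C t (r.1.2.2 - r.2.2.2))| ≤ ε * ‖r.1 - r.2‖ := by
  intro ε hε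
  have hlip := lipschitz_of_uniform_expansion hA hC hz hk
  set K' := n * K + m + 1
  -- The two terms of `hid` receive `ε / 2` each; absolute values and `+ 1` keep the denominators
  -- positive.
  have hη : 0 < ε / (4 * (|K'| + 1)) := by positivity
  have hη' : 0 < ε / (4 * (|N| + 1)) := by positivity
  have hclose := eventually_norm_sub_lt_of_lipschitz hlip hη
  filter_upwards [hlip, hclose.prod_inl_nhds q₀, hclose.prod_inr_nhds q₀, hk _ hη']
    with r h1 h2 h3 h4 t ht
  set R := k r.1 t - k r.2 t - A t (z r.1 t - z r.2 t) - C t (r.1.2.2 - r.2.2.2) with hR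
  -- From `‖a‖² - ‖b‖² = ⟨a + b, a - b⟩`: what is left is a small vector paired with a Lipschitz
  -- increment, and a bounded vector paired with the given remainder.
  have hid : ‖k r.1 t‖ ^ 2 - ‖k r.2 t‖ ^ 2 - 2 * inner ℝ (k q₀ t) (A t (z r.1 t - z r.2 t))
        - 2 * inner ℝ (k q₀ t) (C t (r.1.2.2 - r.2.2.2))
      = inner ℝ ((k r.1 t - k q₀ t) + (k r.2 t - k q₀ t)) (k r.1 t - k r.2 t)
        + 2 * inner ℝ (k q₀ t) R := by
    rw [hR, ← real_inner_self_eq_norm_sq, ← real_inner_self_eq_norm_sq]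
    simp only [inner_sub_left, inner_sub_right, inner_add_left]
    rw [real_inner_comm (k r.1 t) (k r.2 t)]
    ring
  have e1 := abs_real_inner_le_norm ((k r.1 t - k q₀ t) + (k r.2 t - k q₀ t)) (k r.1 t - k r.2 t)
  have e2 := abs_real_inner_le_norm (k q₀ t) R
  have e3 : ‖(k r.1 t - k q₀ t) + (k r.2 t - k q₀ t)‖ ≤ 2 * (ε / (4 * (|K'| + 1))) :=
    (norm_add_le _ _).trans (by linarith [h2 t ht, h3 t ht])
  have e4 : ‖k r.1 t - k r.2 t‖ ≤ (|K'| + 1) * ‖r.1 - r.2‖ :=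
    (h1 t ht).trans (mul_le_mul_of_nonneg_right (by linarith [le_abs_self K']) (norm_nonneg _))
  have e5 := mul_le_mul e3 e4 (norm_nonneg _) (by positivity)
  have e6 := mul_le_mul ((hN t ht).trans (by linarith [le_abs_self N] : N ≤ |N| + 1)) (h4 t ht)
    (norm_nonneg _) (by positivity)
  have e7 : 2 * (ε / (4 * (|K'| + 1))) * ((|K'| + 1) * ‖r.1 - r.2‖) = ε / 2 * ‖r.1 - r.2‖ := by
    field_simp
    norm_num
  have e8 : (|N| + 1) * (ε / (4 * (|N| + 1)) * ‖r.1 - r.2‖) = ε / 4 * ‖r.1 - r.2‖ := by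
    field_simp
  rw [hid]
  refine (abs_add_le _ _).trans ?_
  rw [abs_mul, abs_two]
  linarith

end Remainders

variable {E X : Type*} [NormedAddCommGroup E] [InnerProductSpace ℝ E]
  [NormedAddCommGroup X] [NormedSpace ℝ X]

/-- Integration by parts of `⟨p, e⟩`. The curve `e` need not solve the linearised equation; its
defect `e' - A e` is paired with `p`, which is why no derivative of the flow is required. -/
theorem integral_inner_adjoint_eq [CompleteSpace E] {s T a : ℝ} (hs : s ∈ Icc a T)
    {A : ℝ → E →L[ℝ] E}
    {b p e e' : ℝ → E}
    (hA : ContinuousOn A (Icc a T)) (hb : ContinuousOn b (Icc a T))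
    (he' : ContinuousOn e' (Icc a T))
    (he : ∀ t ∈ Icc a T, HasDerivWithinAt e (e' t) (Icc a T) t)
    (hp : ∀ t ∈ Icc a T, HasDerivWithinAt p (b t - (A t).adjoint (p t)) (Icc a T) t) :
    ∫ t in s..T, (inner ℝ (b t) (e t) + inner ℝ (p t) (e' t - A t (e t)))
      = inner ℝ (p T) (e T) - inner ℝ (p s) (e s) := by
  have hpc : ContinuousOn p (Icc a T) := fun t ht => (hp t ht).continuousWithinAt
  have hec : ContinuousOn e (Icc a T) := fun t ht => (he t ht).continuousWithinAt
  have hsub : Icc s T ⊆ Icc a T := Icc_subset_Icc_left hs.1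
  have hcont : ContinuousOn
      (fun t => inner ℝ (b t) (e t) + inner ℝ (p t) (e' t - A t (e t))) (Icc a T) :=
    (hb.inner hec).add (hpc.inner (he'.sub (hA.clm_apply hec)))
  refine intervalIntegral.integral_eq_sub_of_hasDerivAt_of_le hs.2
    (f := fun t => inner ℝ (p t) (e t)) ((hpc.inner hec).mono hsub) (fun t ht => ?_)
    (hcont.mono (by rwa [uIcc_of_le hs.2])).intervalIntegrable
  have ht' : t ∈ Ioo a T := ⟨hs.1.trans_lt ht.1, ht.2⟩
  have h := ((hp t (Ioo_subset_Icc_self ht')).inner ℝ (he t (Ioo_subset_Icc_self ht'))).hasDerivAt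
    (Icc_mem_nhds ht'.1 ht'.2)
  convert h using 1
  rw [inner_sub_left, inner_sub_right, ContinuousLinearMap.adjoint_inner_left]
  ring

/-- The derivative of the cost `∫_s^T h + G` with respect to the initial time, the initial value and
a parameter, in terms of the adjoint state `p₀ = p(s)`. -/
def costDeriv (p₀ F₀ : E) (h₀ : ℝ) (Lx : X →L[ℝ] ℝ) : ℝ × E × X →L[ℝ] ℝ :=
  (-h₀ + inner ℝ p₀ F₀) • ContinuousLinearMap.fst ℝ ℝ (E × X)
    - (innerSL ℝ p₀).comp
      ((ContinuousLinearMap.fst ℝ E X).comp (ContinuousLinearMap.snd ℝ ℝ (E × X)))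
    + Lx.comp ((ContinuousLinearMap.snd ℝ E X).comp (ContinuousLinearMap.snd ℝ ℝ (E × X)))

theorem costDeriv_apply (p₀ F₀ : E) (h₀ : ℝ) (Lx : X →L[ℝ] ℝ) (δ : ℝ × E × X) :
    costDeriv p₀ F₀ h₀ Lx δ
      = (-h₀ + inner ℝ p₀ F₀) * δ.1 - inner ℝ p₀ δ.2.1 + Lx δ.2.2 := by
  simp [costDeriv]

/-- The cost along a family of solutions of differential equations is strictly differentiable, when
the velocities, the running cost and the terminal cost are strictly differentiable uniformly in
time along the trajectory `z q₀`. -/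
theorem hasStrictFDerivAt_cost [CompleteSpace E] {a T : ℝ} {q₀ : ℝ × E × X}
    (hq₀ : q₀.1 ∈ Ioo a T) {z F : ℝ × E × X → ℝ → E} {h : ℝ × E × X → ℝ → ℝ} {G : ℝ × E × X → ℝ}
    {A : ℝ → E →L[ℝ] E} {b p : ℝ → E} {C : ℝ → X →L[ℝ] E} {c : ℝ → X →L[ℝ] ℝ} {γ : E}
    {Lx : X →L[ℝ] ℝ}
    (hz0 : ∀ᶠ q in 𝓝 q₀, z q q.1 = q.2.1)
    (hzd : ∀ᶠ q in 𝓝 q₀, ∀ t ∈ Icc a T, HasDerivWithinAt (z q) (F q t) (Icc a T) t)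
    (hFc : ∀ᶠ q in 𝓝 q₀, ContinuousOn (F q) (Icc a T))
    (hhc : ∀ᶠ q in 𝓝 q₀, ContinuousOn (h q) (Icc a T))
    (hA : ContinuousOn A (Icc a T)) (hb : ContinuousOn b (Icc a T))
    (hC : ∀ φ, ContinuousOn (fun t => C t φ) (Icc a T))
    (hc : ∀ φ, ContinuousOn (fun t => c t φ) (Icc a T))
    {mC : ℝ} (hmC : ∀ t ∈ Icc a T, ‖C t‖ ≤ mC) {mc : ℝ} (hmc : ∀ t ∈ Icc a T, ‖c t‖ ≤ mc)
    (hF : ∀ ε > 0, ∀ᶠ r : (ℝ × E × X) × (ℝ × E × X) in 𝓝 (q₀, q₀), ∀ t ∈ Icc a T,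
      ‖F r.1 t - F r.2 t - A t (z r.1 t - z r.2 t) - C t (r.1.2.2 - r.2.2.2)‖ ≤ ε * ‖r.1 - r.2‖)
    (hh : ∀ ε > 0, ∀ᶠ r : (ℝ × E × X) × (ℝ × E × X) in 𝓝 (q₀, q₀), ∀ t ∈ Icc a T,
      |h r.1 t - h r.2 t - inner ℝ (b t) (z r.1 t - z r.2 t) - c t (r.1.2.2 - r.2.2.2)|
        ≤ ε * ‖r.1 - r.2‖)
    (hG : (fun r : (ℝ × E × X) × (ℝ × E × X) => G r.1 - G r.2 - inner ℝ γ (z r.1 T - z r.2 T))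
      =o[𝓝 (q₀, q₀)] fun r => r.1 - r.2)
    {K : ℝ} (hz : ∀ᶠ r : (ℝ × E × X) × (ℝ × E × X) in 𝓝 (q₀, q₀), ∀ t ∈ Icc a T,
      ‖z r.1 t - z r.2 t‖ ≤ K * ‖r.1 - r.2‖)
    (hp : ∀ t ∈ Icc a T, HasDerivWithinAt p (b t - (A t).adjoint (p t)) (Icc a T) t)
    (hpT : p T = -γ)
    (hLx : ∀ φ, Lx φ = ∫ t in q₀.1..T, (c t φ - inner ℝ (p t) (C t φ))) :
    HasStrictFDerivAt (fun q => (∫ t in q.1..T, h q t) + G q)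
      (costDeriv (p q₀.1) (F q₀ q₀.1) (h q₀ q₀.1) Lx) q₀ := by
  have haT : a < T := hq₀.1.trans hq₀.2
  obtain ⟨nA, hnA⟩ := isCompact_Icc.exists_bound_of_continuousOn hA
  obtain ⟨nb, hnb⟩ := isCompact_Icc.exists_bound_of_continuousOn hb
  have hF0 := tendsto_of_lipschitz hq₀ hFc.self_of_nhds
    (lipschitz_of_uniform_expansion hnA hmC hz hF)
  have hh0 := tendsto_of_lipschitz hq₀ hhc.self_of_nhds
    (lipschitz_of_uniform_expansion (A := fun t => innerSL ℝ (b t)) (n := nb)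
      (fun t ht => by rw [innerSL_apply_norm]; exact hnb t ht) hmc hz hh)
  have hpc : ContinuousOn p (Icc a T) := fun t ht => (hp t ht).continuousWithinAt
  obtain ⟨m, hm⟩ := isCompact_Icc.exists_bound_of_continuousOn hpc
  have hm0 : 0 ≤ m := (norm_nonneg _).trans (hm q₀.1 (Ioo_subset_Icc_self hq₀))
  have hmem : ∀ᶠ q in 𝓝 q₀, q.1 ∈ Icc a T :=
    continuousAt_fst.eventually (Icc_mem_nhds hq₀.1 hq₀.2)
  -- The density of the derivative with respect to the parameter.
  set k : ℝ → X →L[ℝ] ℝ := fun t => c t - (innerSL ℝ (p t)).comp (C t) with hk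
  have hk_apply : ∀ t φ, k t φ = c t φ - inner ℝ (p t) (C t φ) := fun t φ => by simp [hk]
  have hkm : ∀ t ∈ Icc a T, ‖k t‖ ≤ mc + m * mC := fun t ht => by
    refine (norm_sub_le _ _).trans (add_le_add (hmc t ht) ?_)
    refine (ContinuousLinearMap.opNorm_comp_le _ _).trans ?_
    rw [innerSL_apply_norm]
    exact mul_le_mul (hm t ht) (hmC t ht) (norm_nonneg _) hm0
  -- the remainder in the integrand
  have hR : (fun r : (ℝ × E × X) × (ℝ × E × X) => ∫ t in r.1.1..T,
      ((h r.1 t - h r.2 t - inner ℝ (b t) (z r.1 t - z r.2 t) - c t (r.1.2.2 - r.2.2.2))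
        - inner ℝ (p t)
          (F r.1 t - F r.2 t - A t (z r.1 t - z r.2 t) - C t (r.1.2.2 - r.2.2.2))))
      =o[𝓝 (q₀, q₀)] fun r => r.1 - r.2 := by
    rw [isLittleO_iff]
    intro ε hε
    have hpos : 0 < (1 + m) * (T - a) := mul_pos (by linarith) (by linarith)
    have hη : 0 < ε / ((1 + m) * (T - a)) := div_pos hε hpos
    filter_upwards [hF _ hη, hh _ hη, hmem.prod_inl_nhds q₀] with r hr1 hr2 hr3
    have hεeq : ε = ε / ((1 + m) * (T - a)) * ((1 + m) * (T - a)) :=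
      (div_mul_cancel₀ _ hpos.ne').symm
    set η := ε / ((1 + m) * (T - a))
    refine (intervalIntegral.norm_integral_le_of_norm_le_const
      (C := (1 + m) * (η * ‖r.1 - r.2‖)) fun t ht => ?_).trans ?_
    · have ht' : t ∈ Icc a T := uIcc_subset_Icc hr3 (right_mem_Icc.2 haT.le) (uIoc_subset_uIcc ht)
      refine (norm_sub_le _ _).trans ?_
      have e1 := hr2 t ht'
      have e2 := (norm_inner_le_norm (𝕜 := ℝ) (p t)
        (F r.1 t - F r.2 t - A t (z r.1 t - z r.2 t) - C t (r.1.2.2 - r.2.2.2))).trans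
        (mul_le_mul (hm t ht') (hr1 t ht') (norm_nonneg _) hm0)
      rw [← Real.norm_eq_abs] at e1
      linarith
    · rw [abs_of_nonneg (by linarith [hr3.2]), hεeq]
      have : T - r.1.1 ≤ T - a := by linarith [hr3.1]
      calc (1 + m) * (η * ‖r.1 - r.2‖) * (T - r.1.1)
          ≤ (1 + m) * (η * ‖r.1 - r.2‖) * (T - a) := by gcongr
        _ = _ := by ring
  have hk0 := integral_initial_isLittleO (E := E) hq₀ hkm
  have hh1 := integral_sub_smul_isLittleO hq₀ hhc hh0
  have hp1 : (fun r : (ℝ × E × X) × (ℝ × E × X) => p r.1.1 - p q₀.1)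
      =o[𝓝 (q₀, q₀)] fun _ => (1 : ℝ) := by
    rw [isLittleO_one_iff, tendsto_sub_nhds_zero_iff]
    have h1 : ContinuousAt p q₀.1 := hpc.continuousAt (Icc_mem_nhds hq₀.1 hq₀.2)
    have h2 : ContinuousAt (fun r : (ℝ × E × X) × (ℝ × E × X) => r.1.1) (q₀, q₀) := by fun_prop
    exact ContinuousAt.comp (g := p) (f := fun r : (ℝ × E × X) × (ℝ × E × X) => r.1.1)
      (x := (q₀, q₀)) h1 h2
  have hp2 : (fun r : (ℝ × E × X) × (ℝ × E × X) => p r.1.1) =O[𝓝 (q₀, q₀)] fun _ => (1 : ℝ) :=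
    IsBigO.of_bound m ((hmem.prod_inl_nhds q₀).mono fun r hr => by simpa using hm _ hr)
  have hinner : ∀ u w : (ℝ × E × X) × (ℝ × E × X) → E,
      (fun r => inner ℝ (u r) (w r)) =O[𝓝 (q₀, q₀)] fun r => ‖u r‖ * ‖w r‖ := fun u w =>
    IsBigO.of_bound 1 (Eventually.of_forall fun r => by
      rw [norm_mul, norm_norm, norm_norm, one_mul]
      exact norm_inner_le_norm _ _)
  have hJ1 : (fun r : (ℝ × E × X) × (ℝ × E × X) => inner ℝ (p r.1.1 - p q₀.1)
      ((r.1.1 - r.2.1) • F q₀ q₀.1 - (r.1.2.1 - r.2.2.1))) =o[𝓝 (q₀, q₀)] fun r => r.1 - r.2 := by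
    refine (hinner _ _).trans_isLittleO ?_
    have hO : (fun r : (ℝ × E × X) × (ℝ × E × X) =>
        (r.1.1 - r.2.1) • F q₀ q₀.1 - (r.1.2.1 - r.2.2.1)) =O[𝓝 (q₀, q₀)] fun r => r.1 - r.2 := by
      refine IsBigO.of_bound (‖F q₀ q₀.1‖ + 1) (Eventually.of_forall fun r => ?_)
      refine (norm_sub_le _ _).trans ?_
      rw [norm_smul, Real.norm_eq_abs]
      nlinarith [norm_fst_sub_le r, norm_snd_fst_sub_le r, norm_nonneg (F q₀ q₀.1)]
    simpa using (hp1.norm_left.mul_isBigO hO.norm_norm)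
  have hJ2 : (fun r : (ℝ × E × X) × (ℝ × E × X) => inner ℝ (p r.1.1)
      ((∫ t in r.2.1..r.1.1, F r.2 t) - (r.1.1 - r.2.1) • F q₀ q₀.1))
      =o[𝓝 (q₀, q₀)] fun r => r.1 - r.2 := by
    refine (hinner _ _).trans_isLittleO ?_
    simpa using (hp2.norm_left.mul_isLittleO
      (integral_sub_smul_isLittleO hq₀ hFc hF0).norm_norm)
  -- The total error splits into the integrand remainder, the change of lower limit in the parameter
  -- integral, the running cost between the two initial times, the drift of the second trajectory
  -- between them, the variation of `p` near `q₀.1`, and the terminal remainder.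
  refine HasStrictFDerivAt.of_isLittleO
    ((((((hR.add hk0).sub hh1).add hJ2).add hJ1).add hG).congr' ?_ EventuallyEq.rfl)
  filter_upwards [hmem.prod_inl_nhds q₀, hmem.prod_inr_nhds q₀, hz0.prod_inl_nhds q₀,
    hz0.prod_inr_nhds q₀, hzd.prod_inl_nhds q₀, hzd.prod_inr_nhds q₀, hFc.prod_inl_nhds q₀,
    hFc.prod_inr_nhds q₀, hhc.prod_inl_nhds q₀, hhc.prod_inr_nhds q₀]
    with r hs1 hs2 hz1 hz2 hd1 hd2 hF1 hF2 hc1 hc2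
  have hT : T ∈ Icc a T := right_mem_Icc.2 haT.le
  have hs0 : q₀.1 ∈ Icc a T := Ioo_subset_Icc_self hq₀
  have hzc1 : ContinuousOn (z r.1) (Icc a T) := fun t ht => (hd1 t ht).continuousWithinAt
  have hzc2 : ContinuousOn (z r.2) (Icc a T) := fun t ht => (hd2 t ht).continuousWithinAt
  have hii : ∀ {f : ℝ → ℝ} {u w : ℝ}, ContinuousOn f (Icc a T) → u ∈ Icc a T → w ∈ Icc a T →
      IntervalIntegrable f MeasureTheory.volume u w := fun hf hu hw =>
    (hf.mono (uIcc_subset_Icc hu hw)).intervalIntegrable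
  have hkφ : ContinuousOn (fun t => k t (r.1.2.2 - r.2.2.2)) (Icc a T) := by
    simp only [hk_apply]
    exact (hc _).sub (hpc.inner (hC _))
  have hdual := integral_inner_adjoint_eq hs1 hA hb (hF1.sub hF2)
    (fun t ht => (hd1 t ht).sub (hd2 t ht)) hp
  have hlagr : ContinuousOn (fun t => inner ℝ (b t) (z r.1 t - z r.2 t)
      + inner ℝ (p t) (F r.1 t - F r.2 t - A t (z r.1 t - z r.2 t))) (Icc a T) :=
    (hb.inner (hzc1.sub hzc2)).add
      (hpc.inner ((hF1.sub hF2).sub (hA.clm_apply (hzc1.sub hzc2))))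
  have hRem : (∫ t in r.1.1..T,
      ((h r.1 t - h r.2 t - inner ℝ (b t) (z r.1 t - z r.2 t) - c t (r.1.2.2 - r.2.2.2))
        - inner ℝ (p t)
          (F r.1 t - F r.2 t - A t (z r.1 t - z r.2 t) - C t (r.1.2.2 - r.2.2.2))))
      = (∫ t in r.1.1..T, h r.1 t) - (∫ t in r.1.1..T, h r.2 t)
        - (∫ t in r.1.1..T, k t (r.1.2.2 - r.2.2.2))
        - (inner ℝ (p T) (z r.1 T - z r.2 T) - inner ℝ (p r.1.1) (z r.1 r.1.1 - z r.2 r.1.1)) := by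
    have hh12 : ContinuousOn (fun t => h r.1 t - h r.2 t) (Icc a T) := hc1.sub hc2
    have hh12k : ContinuousOn (fun t => h r.1 t - h r.2 t - k t (r.1.2.2 - r.2.2.2)) (Icc a T) :=
      hh12.sub hkφ
    simp only [Pi.sub_apply] at hdual
    rw [← hdual, ← intervalIntegral.integral_sub (hii hc1 hs1 hT) (hii hc2 hs1 hT),
      ← intervalIntegral.integral_sub (hii hh12 hs1 hT) (hii hkφ hs1 hT),
      ← intervalIntegral.integral_sub (hii hh12k hs1 hT) (hii hlagr hs1 hT)]
    refine intervalIntegral.integral_congr fun t _ => ?_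
    simp only [hk_apply, inner_sub_right]
    ring
  -- Both trajectories are compared at the initial time of the first, so the second is transported
  -- there by its own velocity.
  have hz21 : z r.2 r.1.1 = r.2.2.1 + ∫ t in r.2.1..r.1.1, F r.2 t := by
    have hint : IntervalIntegrable (F r.2) MeasureTheory.volume r.2.1 r.1.1 :=
      (hF2.mono (uIcc_subset_Icc hs2 hs1)).intervalIntegrable
    rw [intervalIntegral.integral_eq_sub_of_hasDeriv_right (f := z r.2)
      (hzc2.mono (uIcc_subset_Icc hs2 hs1)) (fun t ht => ?_) hint, hz2]
    · abel
    · have ht' : t ∈ Ioo a T := ⟨(le_min hs2.1 hs1.1).trans_lt ht.1,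
        ht.2.trans_le (max_le hs2.2 hs1.2)⟩
      exact ((hd2 t (Ioo_subset_Icc_self ht')).hasDerivAt
        (Icc_mem_nhds ht'.1 ht'.2)).hasDerivWithinAt
  have hadd1 := intervalIntegral.integral_add_adjacent_intervals (hii hkφ hs1 hs0) (hii hkφ hs0 hT)
  have hadd2 := intervalIntegral.integral_add_adjacent_intervals (hii hc2 hs2 hs1) (hii hc2 hs1 hT)
  have hL : Lx (r.1.2.2 - r.2.2.2) = ∫ t in q₀.1..T, k t (r.1.2.2 - r.2.2.2) := by
    simp only [hk_apply, hLx]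
  rw [hRem, hpT, hz1, hz21, costDeriv_apply, Prod.snd_sub, Prod.snd_sub, Prod.fst_sub, Prod.fst_sub,
    hL, ← hadd1, ← hadd2]
  simp only [inner_sub_left, inner_sub_right, inner_add_right, inner_neg_left,
    real_inner_smul_right,
    smul_eq_mul]
  ring

end StrictDerivative

/-! ### Calculus in `C([0,T]; C¹(Ω̄; F))`. -/

section FunctionSpaces

open scoped BoundedContinuousFunction

variable {d : ℕ} {Ω : Set (Euc d)} {F G : Type*} [NormedAddCommGroup F] [NormedSpace ℝ F]
  [NormedAddCommGroup G] [NormedSpace ℝ G]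

theorem zeroExt_of_mem {α Z : Type*} [Zero Z] {S : Set α} (u : S → Z) {x : α} (h : x ∈ S) :
    zeroExt u x = u ⟨x, h⟩ := by
  simp [zeroExt, h]

theorem zeroExt_map {α Z Z' : Type*} [Zero Z] [Zero Z'] {S : Set α} (u : S → Z) (A : Z → Z')
    (hA : A 0 = 0) : zeroExt (fun s => A (u s)) = fun x => A (zeroExt u x) := by
  funext x
  by_cases h : x ∈ S <;> simp [zeroExt, h, hA]

theorem norm_fn_le (u : C1 Ω F) : ‖fn u‖ ≤ ‖u‖ := norm_fst_le (E := closure Ω →ᵇ F) u.1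

theorem norm_der_le (u : C1 Ω F) : ‖der u‖ ≤ ‖u‖ := norm_snd_le (E := closure Ω →ᵇ F) u.1

theorem norm_C1_le {u : C1 Ω F} {c : ℝ} (h1 : ‖fn u‖ ≤ c) (h2 : ‖der u‖ ≤ c) : ‖u‖ ≤ c :=
  max_le h1 h2

theorem fn_add (u w : C1 Ω F) : fn (u + w) = fn u + fn w := rfl

theorem fn_smul (c : ℝ) (u : C1 Ω F) : fn (c • u) = c • fn u := rfl

theorem fn_zero : fn (0 : C1 Ω F) = 0 := rfl

theorem der_zero : der (0 : C1 Ω F) = 0 := rfl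

theorem hasFDerivAt_zeroExt_fn (u : C1 Ω F) {x : Euc d} (hx : x ∈ Ω) :
    HasFDerivAt (zeroExt (fn u)) (zeroExt (der u) x) x := by
  rw [zeroExt_of_mem _ (subset_closure hx)]
  exact u.2 x hx

/-- `fn` as a continuous linear map. -/
def fnCLM (Ω : Set (Euc d)) (F : Type*) [NormedAddCommGroup F] [NormedSpace ℝ F] :
    C1 Ω F →L[ℝ] (closure Ω →ᵇ F) :=
  LinearMap.mkContinuous
    { toFun := fn, map_add' := fun _ _ => rfl, map_smul' := fun _ _ => rfl } 1
    fun u => (norm_fn_le u).trans_eq (one_mul _).symm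

/-- `der` as a continuous linear map. -/
def derCLM (Ω : Set (Euc d)) (F : Type*) [NormedAddCommGroup F] [NormedSpace ℝ F] :
    C1 Ω F →L[ℝ] (closure Ω →ᵇ (Euc d →L[ℝ] F)) :=
  LinearMap.mkContinuous
    { toFun := der, map_add' := fun _ _ => rfl, map_smul' := fun _ _ => rfl } 1
    fun u => (norm_der_le u).trans_eq (one_mul _).symm

/-- Composition of `C¹` functions with a continuous linear map. -/
def C1.postcomp (A : F →L[ℝ] G) : C1 Ω F →L[ℝ] C1 Ω G :=
  LinearMap.mkContinuous
    { toFun := fun u => ⟨(A.compLeftContinuousBounded (closure Ω) (fn u),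
          (ContinuousLinearMap.compL ℝ (Euc d) F G A).compLeftContinuousBounded (closure Ω)
            (der u)), fun x hx => by
          have h := A.hasFDerivAt.comp x (u.2 x hx)
          have h2 := zeroExt_map (fn u) A A.map_zero
          exact h2 ▸ h⟩
      map_add' := fun u w => Subtype.ext (Prod.ext (map_add _ (fn u) (fn w))
        (map_add _ (der u) (der w)))
      map_smul' := fun c u => Subtype.ext (Prod.ext (map_smul _ c (fn u))
        (map_smul _ c (der u))) } ‖A‖
    fun u => by
      refine norm_C1_le ?_ ?_
      · refine (BoundedContinuousFunction.norm_le (by positivity)).2 fun x => ?_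
        exact A.le_of_opNorm_le_of_le le_rfl (((fn u).norm_coe_le_norm x).trans (norm_fn_le u))
      · refine (BoundedContinuousFunction.norm_le (by positivity)).2 fun x => ?_
        refine (A.opNorm_comp_le _).trans ?_
        gcongr
        exact ((der u).norm_coe_le_norm x).trans (norm_der_le u)

theorem fn_postcomp (A : F →L[ℝ] G) (u : C1 Ω F) (x : closure Ω) :
    fn (C1.postcomp A u) x = A (fn u x) := rfl

variable {T : ℝ}

/-- The spatial derivative of `φ` at `(t, x)`, for `t ∈ [0,T]` and `x ∈ Ω̄`. -/
def dval (φ : CtC1 T Ω F) (t : ℝ) (x : Euc d) : Euc d →L[ℝ] F :=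
  zeroExt (der (zeroExt φ t)) x

theorem val_apply (φ : CtC1 T Ω F) {t : ℝ} (ht : t ∈ Icc 0 T) {x : Euc d} (hx : x ∈ closure Ω) :
    val φ t x = fn (φ ⟨t, ht⟩) ⟨x, hx⟩ := by
  rw [val, zeroExt_of_mem _ hx, zeroExt_of_mem _ ht]

theorem dval_apply (φ : CtC1 T Ω F) {t : ℝ} (ht : t ∈ Icc 0 T) {x : Euc d} (hx : x ∈ closure Ω) :
    dval φ t x = der (φ ⟨t, ht⟩) ⟨x, hx⟩ := by
  rw [dval, zeroExt_of_mem _ hx, zeroExt_of_mem _ ht]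

theorem val_add (φ ψ : CtC1 T Ω F) (t : ℝ) (x : Euc d) :
    val (φ + ψ) t x = val φ t x + val ψ t x := by
  by_cases ht : t ∈ Icc 0 T <;> by_cases hx : x ∈ closure Ω <;>
    simp [val, zeroExt, ht, hx, fn_add, fn_zero]

theorem val_smul (c : ℝ) (φ : CtC1 T Ω F) (t : ℝ) (x : Euc d) :
    val (c • φ) t x = c • val φ t x := by
  by_cases ht : t ∈ Icc 0 T <;> by_cases hx : x ∈ closure Ω <;>
    simp [val, zeroExt, ht, hx, fn_smul, fn_zero]

theorem norm_val_le (φ : CtC1 T Ω F) (t : ℝ) (x : Euc d) : ‖val φ t x‖ ≤ ‖φ‖ := by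
  by_cases hx : x ∈ closure Ω
  · by_cases ht : t ∈ Icc 0 T
    · rw [val_apply φ ht hx]
      exact ((fn _).norm_coe_le_norm _).trans ((norm_fn_le _).trans (φ.norm_coe_le_norm _))
    · simp [val, zeroExt, ht, hx, fn_zero]
  · simp [val, zeroExt, hx]

theorem norm_dval_le (φ : CtC1 T Ω F) (t : ℝ) (x : Euc d) : ‖dval φ t x‖ ≤ ‖φ‖ := by
  by_cases hx : x ∈ closure Ω
  · by_cases ht : t ∈ Icc 0 T
    · rw [dval_apply φ ht hx]
      exact ((der _).norm_coe_le_norm _).trans ((norm_der_le _).trans (φ.norm_coe_le_norm _))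
    · simp [dval, zeroExt, ht, hx, der_zero]
  · simp [dval, zeroExt, hx]

theorem hasFDerivAt_val (φ : CtC1 T Ω F) (t : ℝ) {x : Euc d} (hx : x ∈ Ω) :
    HasFDerivAt (val φ t) (dval φ t x) x :=
  hasFDerivAt_zeroExt_fn _ hx

/-- Evaluation of `φ` at `(t, x)` as a continuous linear map. -/
def evalCLM (T : ℝ) (Ω : Set (Euc d)) (F : Type*) [NormedAddCommGroup F] [NormedSpace ℝ F] (t : ℝ)
    (x : Euc d) : CtC1 T Ω F →L[ℝ] F :=
  LinearMap.mkContinuous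
    { toFun := fun φ => val φ t x
      map_add' := fun φ ψ => val_add φ ψ t x
      map_smul' := fun c φ => val_smul c φ t x } 1 fun φ => by simpa using norm_val_le φ t x

theorem norm_evalCLM_le (t : ℝ) (x : Euc d) : ‖evalCLM T Ω F t x‖ ≤ 1 :=
  LinearMap.mkContinuous_norm_le _ zero_le_one _

theorem val_sub (φ ψ : CtC1 T Ω F) (t : ℝ) (x : Euc d) :
    val (φ - ψ) t x = val φ t x - val ψ t x :=
  map_sub (evalCLM T Ω F t x) φ ψ

theorem continuousOn_val (φ : CtC1 T Ω F) :
    ContinuousOn (fun r : ℝ × Euc d => val φ r.1 r.2) (Icc 0 T ×ˢ closure Ω) := by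
  rw [continuousOn_iff_continuous_domRestrict]
  have h : Continuous fun r : ↥(Icc 0 T ×ˢ closure Ω) =>
      fnCLM Ω F (φ ⟨r.1.1, r.2.1⟩) ⟨r.1.2, r.2.2⟩ := by
    fun_prop
  refine h.congr fun r => ?_
  exact (val_apply φ r.2.1 r.2.2).symm

theorem continuousOn_dval (φ : CtC1 T Ω F) :
    ContinuousOn (fun r : ℝ × Euc d => dval φ r.1 r.2) (Icc 0 T ×ˢ closure Ω) := by
  rw [continuousOn_iff_continuous_domRestrict]
  have h : Continuous fun r : ↥(Icc 0 T ×ˢ closure Ω) =>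
      derCLM Ω F (φ ⟨r.1.1, r.2.1⟩) ⟨r.1.2, r.2.2⟩ := by
    fun_prop
  refine h.congr fun r => ?_
  exact (dval_apply φ r.2.1 r.2.2).symm

theorem continuousOn_val_comp (φ : CtC1 T Ω F) {s : Set ℝ} (hs : s ⊆ Icc 0 T) {y : ℝ → Euc d}
    (hy : ContinuousOn y s) (hmem : ∀ t ∈ s, y t ∈ closure Ω) :
    ContinuousOn (fun t => val φ t (y t)) s :=
  (continuousOn_val φ).comp (f := fun t => (t, y t)) (continuousOn_id.prodMk hy)
    fun t ht => ⟨hs ht, hmem t ht⟩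

theorem continuousOn_dval_comp (φ : CtC1 T Ω F) {s : Set ℝ} (hs : s ⊆ Icc 0 T) {y : ℝ → Euc d}
    (hy : ContinuousOn y s) (hmem : ∀ t ∈ s, y t ∈ closure Ω) :
    ContinuousOn (fun t => dval φ t (y t)) s :=
  (continuousOn_dval φ).comp (f := fun t => (t, y t)) (continuousOn_id.prodMk hy)
    fun t ht => ⟨hs ht, hmem t ht⟩

/-- Convexity turns the bound on the derivative into a Lipschitz constant on `Ω`, and continuity
carries it to `Ω̄`. -/
theorem norm_val_sub_le (hΩ : Convex ℝ Ω) (φ : CtC1 T Ω F) {t : ℝ} (ht : t ∈ Icc 0 T)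
    {x x' : Euc d} (hx : x ∈ closure Ω) (hx' : x' ∈ closure Ω) :
    ‖val φ t x - val φ t x'‖ ≤ ‖φ‖ * ‖x - x'‖ := by
  have h : LipschitzOnWith ‖φ‖₊ (val φ t) Ω :=
    hΩ.lipschitzOnWith_of_nnnorm_hasFDerivWithin_le
      (fun x hx => (hasFDerivAt_val φ t hx).hasFDerivWithinAt) fun x _ => norm_dval_le φ t x
  have hc : ContinuousOn (val φ t) (closure Ω) :=
    (continuousOn_val φ).comp (f := fun x => (t, x)) (by fun_prop) fun x hx => ⟨ht, hx⟩
  simpa [dist_eq_norm] using (h.closure hc).dist_le_mul x hx x' hx'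

/-- Uniform strict differentiability of a `C¹` function. -/
theorem exists_norm_val_sub_sub_le (hconv : Convex ℝ Ω) (hbd : Bornology.IsBounded Ω)
    (φ : CtC1 T Ω F) {ε : ℝ} (hε : 0 < ε) :
    ∃ δ > 0, ∀ t ∈ Icc 0 T, ∀ x ∈ Ω, ∀ x₁ ∈ Ω, ∀ x₂ ∈ Ω, ‖x₁ - x‖ < δ → ‖x₂ - x‖ < δ →
      ‖val φ t x₁ - val φ t x₂ - dval φ t x (x₁ - x₂)‖ ≤ ε * ‖x₁ - x₂‖ := by
  -- Compactness of `[0,T] × Ω̄` makes `δ` independent of `t` and `x`; the mean value inequality is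
  -- then used on the convex set `Ω ∩ ball x δ`.
  have huc : UniformContinuousOn (fun r : ℝ × Euc d => dval φ r.1 r.2) (Icc 0 T ×ˢ closure Ω) :=
    (isCompact_Icc.prod hbd.isCompact_closure).uniformContinuousOn_of_continuous
      (continuousOn_dval φ)
  obtain ⟨δ, hδ, h⟩ := Metric.uniformContinuousOn_iff.1 huc ε hε
  refine ⟨δ, hδ, fun t ht x hx x₁ hx₁ x₂ hx₂ h₁ h₂ => ?_⟩
  have hball : ∀ {w}, ‖w - x‖ < δ → w ∈ Metric.ball x δ := fun hw => by
    rwa [Metric.mem_ball, dist_eq_norm]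
  refine (hconv.inter (convex_ball x δ)).norm_image_sub_le_of_norm_hasFDerivWithin_le'
    (f' := fun w => dval φ t w)
    (fun w hw => (hasFDerivAt_val φ t hw.1).hasFDerivWithinAt) (fun w hw => ?_)
    ⟨hx₂, hball h₂⟩ ⟨hx₁, hball h₁⟩
  have := h (t, w) ⟨ht, subset_closure hw.1⟩ (t, x) ⟨ht, subset_closure hx⟩
    (by simpa [Prod.dist_eq] using hw.2)
  rw [dist_eq_norm] at this
  exact this.le

/-- Uniform strict differentiability of `(φ, x) ↦ φ(t, x)`. -/
theorem exists_norm_val_expansion_le (hconv : Convex ℝ Ω) (hbd : Bornology.IsBounded Ω)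
    (φ : CtC1 T Ω F) {ε : ℝ} (hε : 0 < ε) :
    ∃ δ > 0, ∀ φ₁ φ₂ : CtC1 T Ω F, ‖φ₁ - φ‖ < δ → ∀ t ∈ Icc 0 T, ∀ x ∈ Ω, ∀ x₁ ∈ Ω, ∀ x₂ ∈ Ω,
      ‖x₁ - x‖ < δ → ‖x₂ - x‖ < δ →
      ‖val φ₁ t x₁ - val φ₂ t x₂ - dval φ t x (x₁ - x₂) - val (φ₁ - φ₂) t x‖
        ≤ ε * (‖x₁ - x₂‖ + ‖φ₁ - φ₂‖) := by
  obtain ⟨δ, hδ, h⟩ := exists_norm_val_sub_sub_le hconv hbd φ (half_pos hε)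
  refine ⟨min δ (ε / 2), lt_min hδ (half_pos hε), fun φ₁ φ₂ hφ t ht x hx x₁ hx₁ x₂ hx₂ h₁ h₂ => ?_⟩
  have e1 := h t ht x hx x₁ hx₁ x₂ hx₂ (h₁.trans_le (min_le_left _ _))
    (h₂.trans_le (min_le_left _ _))
  have e2 := norm_val_sub_le hconv (φ₁ - φ) ht (subset_closure hx₁) (subset_closure hx₂)
  have e3 := norm_val_sub_le hconv (φ₁ - φ₂) ht (subset_closure hx₂) (subset_closure hx)
  have hφ' := (hφ.trans_le (min_le_right _ _)).le
  have h₂' := (h₂.trans_le (min_le_right _ _)).le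
  have e4 := mul_le_mul_of_nonneg_right hφ' (norm_nonneg (x₁ - x₂))
  have e5 := mul_le_mul_of_nonneg_left h₂' (norm_nonneg (φ₁ - φ₂))
  -- First-order error of `φ`, then a term with small Lipschitz constant `‖φ₁ - φ‖`, then a term
  -- with small displacement `x₂ - x`. The last two explain the `ε / 2` in the choice of radius.
  have e6 : val φ₁ t x₁ - val φ₂ t x₂ - dval φ t x (x₁ - x₂) - val (φ₁ - φ₂) t x
      = (val φ t x₁ - val φ t x₂ - dval φ t x (x₁ - x₂))
        + (val (φ₁ - φ) t x₁ - val (φ₁ - φ) t x₂)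
        + (val (φ₁ - φ₂) t x₂ - val (φ₁ - φ₂) t x) := by
    simp only [val_sub]
    abel
  rw [e6]
  refine norm_add₃_le.trans ?_
  have := mul_nonneg hε.le (norm_nonneg (φ₁ - φ₂))
  nlinarith

/-- The second entry of an element of `C²(Ω̄)`: its derivative, as an element of `C¹`. -/
def C2.derivC1 (Ω : Set (Euc d)) : C2 Ω →L[ℝ] C1 Ω (Euc d →L[ℝ] ℝ) :=
  (ContinuousLinearMap.snd ℝ (C1 Ω ℝ) (C1 Ω (Euc d →L[ℝ] ℝ))).comp (C2Sub Ω).subtypeL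

theorem fn_derivC1 (w : C2 Ω) : fn (C2.derivC1 Ω w) = der (C2.toC1 Ω w) := w.2.symm

/-- The inverse of the Riesz isomorphism, as a linear map. -/
def rieszSymm (d : ℕ) : (Euc d →L[ℝ] ℝ) →L[ℝ] Euc d :=
  LinearMap.toContinuousLinearMap
    { toFun := (InnerProductSpace.toDual ℝ (Euc d)).symm
      map_add' := map_add _
      map_smul' := fun c u => by simp }

theorem rieszSymm_apply (u : Euc d →L[ℝ] ℝ) :
    rieszSymm d u = (InnerProductSpace.toDual ℝ (Euc d)).symm u := rfl

theorem grad_eq (φ : CtC1 T Ω ℝ) (t : ℝ) (x : Euc d) : grad φ t x = rieszSymm d (dval φ t x) := rfl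

theorem inner_grad (φ : CtC1 T Ω ℝ) (t : ℝ) (x e : Euc d) :
    inner ℝ (grad φ t x) e = dval φ t x e := by
  rw [grad, InnerProductSpace.toDual_symm_apply]
  rfl

theorem norm_grad_le (φ : CtC1 T Ω ℝ) (t : ℝ) (x : Euc d) : ‖grad φ t x‖ ≤ ‖φ‖ := by
  rw [grad, LinearIsometryEquiv.norm_map]
  exact norm_dval_le φ t x

end FunctionSpaces

/-! ### Density of `C²` in `C¹`. -/

section Density

open scoped BoundedContinuousFunction ContDiff
open Filter

/-- `C¹` approximation by smooth functions of compactly supported `C¹` functions. -/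
theorem exists_contDiff_dist_fderiv_le {E : Type*} [NormedAddCommGroup E] [NormedSpace ℝ E]
    [FiniteDimensional ℝ E] {v : E → ℝ} (hv : ContDiff ℝ 1 v) (hsupp : HasCompactSupport v) {ε : ℝ}
    (hε : 0 < ε) :
    ∃ ψ : E → ℝ, ContDiff ℝ ∞ ψ ∧ ∀ x, dist (ψ x) (v x) ≤ ε ∧
      dist (fderiv ℝ ψ x) (fderiv ℝ v x) ≤ ε := by
  borelize E
  have hdc : Continuous (fderiv ℝ v) := hv.continuous_fderiv one_ne_zero
  have hu1 := hsupp.uniformContinuous_of_continuous hv.continuous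
  have hu2 := (hsupp.fderiv ℝ).uniformContinuous_of_continuous hdc
  obtain ⟨δ₁, hδ₁, h₁⟩ := Metric.uniformContinuous_iff.1 hu1 ε hε
  obtain ⟨δ₂, hδ₂, h₂⟩ := Metric.uniformContinuous_iff.1 hu2 ε hε
  let φ : ContDiffBump (0 : E) :=
    ⟨min δ₁ δ₂ / 2, min δ₁ δ₂, half_pos (lt_min hδ₁ hδ₂), half_lt_self (lt_min hδ₁ hδ₂)⟩
  let μ : MeasureTheory.Measure E := MeasureTheory.Measure.addHaar
  let ψ : E → ℝ := MeasureTheory.convolution (φ.normed μ) v (ContinuousLinearMap.lsmul ℝ ℝ) μ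
  have hL : (ContinuousLinearMap.lsmul ℝ ℝ : ℝ →L[ℝ] ℝ →L[ℝ] ℝ).precompR E
      = ContinuousLinearMap.lsmul ℝ ℝ := by
    ext
    simp [ContinuousLinearMap.precompR]
  -- The derivative falls on `v`, so it is a mollification of `fderiv ℝ v` by the same kernel and
  -- obeys the same kind of estimate.
  have hd : ∀ x, HasFDerivAt ψ (MeasureTheory.convolution (φ.normed μ) (fderiv ℝ v)
      (ContinuousLinearMap.lsmul ℝ ℝ) μ x) x := fun x => by
    have h := hsupp.hasFDerivAt_convolution_right (ContinuousLinearMap.lsmul ℝ ℝ)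
      ((φ.continuous_normed (μ := μ)).locallyIntegrable (μ := μ)) hv x
    rwa [hL] at h
  refine ⟨ψ, φ.hasCompactSupport_normed.contDiff_convolution_left _ φ.contDiff_normed
    hv.continuous.locallyIntegrable, fun x => ⟨?_, ?_⟩⟩
  · exact φ.dist_normed_convolution_le hv.continuous.aestronglyMeasurable
      fun w hw => (h₁ (lt_of_lt_of_le hw (min_le_left _ _))).le
  · rw [(hd x).fderiv]
    exact φ.dist_normed_convolution_le hdc.aestronglyMeasurable
      fun w hw => (h₂ (lt_of_lt_of_le hw (min_le_right _ _))).le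

/-- A function that is `C¹` on an open set coincides near a given compact subset with a compactly
supported `C¹` function. -/
theorem exists_contDiff_hasCompactSupport_eventuallyEq {E : Type*} [NormedAddCommGroup E]
    [NormedSpace ℝ E] [FiniteDimensional ℝ E] {u : E → ℝ} {Ω K : Set E} (hΩ : IsOpen Ω)
    (hu : ContDiffOn ℝ 1 u Ω) (hK : IsCompact K) (hKΩ : K ⊆ Ω) :
    ∃ v : E → ℝ, ContDiff ℝ 1 v ∧ HasCompactSupport v ∧ ∀ x ∈ K, v =ᶠ[𝓝 x] u := by
  obtain ⟨K', hK', hKK', hK'Ω⟩ := exists_compact_between hK hΩ hKΩ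
  obtain ⟨f, hf1, hf0, -⟩ := exists_contMDiffMap_one_nhds_of_subset_interior
    (modelWithCornersSelf ℝ E) (n := 1) hK.isClosed hKK'
  have hf : ContDiff ℝ 1 f := f.contMDiff.contDiff
  have hts : tsupport (fun x => f x * u x) ⊆ K' := by
    refine closure_minimal (fun x hx => ?_) hK'.isClosed
    by_contra hxK
    exact hx (by simp [hf0 x hxK])
  refine ⟨fun x => f x * u x, ?_, hK'.of_isClosed_subset (isClosed_tsupport _) hts, ?_⟩
  · rw [contDiff_iff_contDiffAt]
    intro x
    by_cases hx : x ∈ Ω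
    · exact hf.contDiffAt.mul (hu.contDiffAt (hΩ.mem_nhds hx))
    · have hx' : x ∉ tsupport (fun x => f x * u x) := fun h => hx (hK'Ω (hts h))
      exact contDiffAt_const.congr_of_eventuallyEq (notMem_tsupport_iff_eventuallyEq.1 hx')
  · intro x hx
    filter_upwards [eventually_nhdsSet_iff_forall.1 hf1 x hx] with w hw
    rw [hw, one_mul]

variable {d : ℕ} {Ω : Set (Euc d)}

theorem contDiffOn_zeroExt_fn (hΩ : IsOpen Ω) (u : C1 Ω ℝ) :
    ContDiffOn ℝ 1 (zeroExt (fn u)) Ω := by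
  have h1 : ∀ x ∈ Ω, fderiv ℝ (zeroExt (fn u)) x = zeroExt (der u) x := fun x hx =>
    (hasFDerivAt_zeroExt_fn u hx).fderiv
  have h2 : ContinuousOn (zeroExt (der u)) (closure Ω) := by
    rw [continuousOn_iff_continuous_domRestrict]
    exact (der u).continuous.congr fun x => (zeroExt_of_mem _ x.2).symm
  rw [show (1 : WithTop ℕ∞) = 0 + 1 from rfl, contDiffOn_succ_iff_fderiv_of_isOpen hΩ]
  refine ⟨fun x hx => (hasFDerivAt_zeroExt_fn u hx).differentiableAt.differentiableWithinAt,
    by simp, ?_⟩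
  rw [contDiffOn_zero]
  exact (h2.mono subset_closure).congr h1

/-- The restriction of a smooth function, as an element of `C¹(Ω̄; F)`. -/
def C1.ofContDiff {F : Type*} [NormedAddCommGroup F] [NormedSpace ℝ F] (hΩ : IsOpen Ω)
    [CompactSpace (closure Ω)] (ψ : Euc d → F) (hψ : ContDiff ℝ 1 ψ) : C1 Ω F :=
  ⟨(BoundedContinuousFunction.mkOfCompact ⟨fun x : closure Ω => ψ x, by
      have := hψ.continuous
      fun_prop⟩,
    BoundedContinuousFunction.mkOfCompact ⟨fun x : closure Ω => fderiv ℝ ψ x, by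
      have := hψ.continuous_fderiv one_ne_zero
      fun_prop⟩), fun x hx => by
    have h := (hψ.differentiable one_ne_zero x).hasFDerivAt
    refine h.congr_of_eventuallyEq ?_
    filter_upwards [hΩ.mem_nhds hx] with w hw
    exact zeroExt_of_mem _ (subset_closure hw)⟩

/-- The restriction of a smooth function, as an element of `C²(Ω̄)`. -/
def C2.ofContDiff (hΩ : IsOpen Ω) [CompactSpace (closure Ω)] (ψ : Euc d → ℝ)
    (hψ : ContDiff ℝ 2 ψ) : C2 Ω :=
  ⟨(C1.ofContDiff hΩ ψ (hψ.of_le one_le_two),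
    C1.ofContDiff hΩ (fderiv ℝ ψ) (hψ.fderiv_right (m := 1) le_rfl)), rfl⟩

/-- `C²(Ω̄)` is dense in `C¹(Ω̄)`. -/
theorem exists_norm_toC1_sub_le (hΩ : IsOpen Ω) (hconv : Convex ℝ Ω)
    (hbd : Bornology.IsBounded Ω) (hne : Ω.Nonempty) (u : C1 Ω ℝ) {ε : ℝ} (hε : 0 < ε) :
    ∃ w : C2 Ω, ‖C2.toC1 Ω w - u‖ ≤ ε := by
  obtain ⟨x₀, hx₀⟩ := hne
  have hcomp : IsCompact (closure Ω) := hbd.isCompact_closure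
  have : CompactSpace (closure Ω) := isCompact_iff_compactSpace.1 hcomp
  have hu1 := CompactSpace.uniformContinuous_of_continuous (fn u).continuous
  have hu2 := CompactSpace.uniformContinuous_of_continuous (der u).continuous
  obtain ⟨δ₁, hδ₁, h₁⟩ := Metric.uniformContinuous_iff.1 hu1 (ε / 3) (by positivity)
  obtain ⟨δ₂, hδ₂, h₂⟩ := Metric.uniformContinuous_iff.1 hu2 (ε / 3) (by positivity)
  obtain ⟨R, hR⟩ := hcomp.isBounded.exists_norm_le
  -- The second condition keeps the displacement of the contraction below the moduli of continuity
  -- of `u` and `Du`; the third absorbs the factor `1 - κ` from the chain rule.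
  have hev : ∀ᶠ κ in 𝓝[>] (0 : ℝ), κ ∈ Ioo 0 1 ∧ κ * (‖x₀‖ + R) < min δ₁ δ₂ ∧
      κ * ‖der u‖ < ε / 3 := by
    have c1 : Tendsto (fun κ : ℝ => κ * (‖x₀‖ + R)) (𝓝[>] 0) (𝓝 0) :=
      tendsto_nhdsWithin_of_tendsto_nhds (by
        have h : Continuous fun κ : ℝ => κ * (‖x₀‖ + R) := by fun_prop
        simpa using h.tendsto 0)
    have c2 : Tendsto (fun κ : ℝ => κ * ‖der u‖) (𝓝[>] 0) (𝓝 0) :=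
      tendsto_nhdsWithin_of_tendsto_nhds (by
        have h : Continuous fun κ : ℝ => κ * ‖der u‖ := by fun_prop
        simpa using h.tendsto 0)
    refine Filter.Eventually.and (Ioo_mem_nhdsGT one_pos) (
      (c1.eventually (gt_mem_nhds (lt_min hδ₁ hδ₂))).and
      (c2.eventually (gt_mem_nhds (by positivity))))
  obtain ⟨κ, ⟨hκ0, hκ1⟩, hκδ, hκu⟩ := hev.exists
  -- the contraction towards `x₀`
  let m : Euc d → Euc d := fun x => κ • x₀ + (1 - κ) • x
  have hm : Continuous m := by fun_prop
  have hmd : ∀ x, HasFDerivAt m ((1 - κ) • ContinuousLinearMap.id ℝ (Euc d)) x := fun x =>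
    ((hasFDerivAt_id x).const_smul (1 - κ)).const_add _
  -- By convexity the contraction sends the compact set `Ω̄` into the open set `Ω`, which leaves
  -- room to cut off and mollify.
  have hmΩ : ∀ x ∈ closure Ω, m x ∈ Ω := fun x hx => by
    have := hconv.combo_interior_closure_mem_interior (by rwa [hΩ.interior_eq]) hx hκ0
      (sub_nonneg.2 hκ1.le) (by ring)
    rwa [hΩ.interior_eq] at this
  have hmdist : ∀ x ∈ closure Ω, dist (m x) x < min δ₁ δ₂ := fun x hx => by
    refine lt_of_le_of_lt ?_ hκδ
    have : m x - x = κ • (x₀ - x) := by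
      simp only [m]
      module
    rw [dist_eq_norm, this, norm_smul, Real.norm_of_nonneg hκ0.le]
    gcongr
    exact (norm_sub_le _ _).trans (add_le_add_right (hR x hx) _)
  obtain ⟨v, hv, hvs, hvu⟩ := exists_contDiff_hasCompactSupport_eventuallyEq hΩ
    (contDiffOn_zeroExt_fn hΩ u) (hcomp.image hm) (image_subset_iff.2 hmΩ)
  obtain ⟨ψ, hψ, hψv⟩ := exists_contDiff_dist_fderiv_le hv hvs (ε := ε / 3) (by positivity)
  have hψm : ContDiff ℝ 2 (ψ ∘ m) :=
    by
    have hm2 : ContDiff ℝ 2 m := by fun_prop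
    exact (contDiff_infty.1 hψ 2).comp hm2
  refine ⟨C2.ofContDiff hΩ (ψ ∘ m) hψm, norm_C1_le ?_ ?_⟩
  · refine (BoundedContinuousFunction.norm_le hε.le).2 fun x => ?_
    have e1 := (hψv (m x)).1
    rw [(hvu _ (mem_image_of_mem m x.2)).eq_of_nhds,
      zeroExt_of_mem _ (subset_closure (hmΩ x x.2))] at e1
    have e2 := (h₁ (a := ⟨m x, subset_closure (hmΩ x x.2)⟩) (b := x)
      ((hmdist x x.2).trans_le (min_le_left _ _))).le
    have e3 := dist_triangle (ψ (m x)) (fn u ⟨m x, subset_closure (hmΩ x x.2)⟩) (fn u x)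
    change ‖ψ (m x) - fn u x‖ ≤ ε
    rw [← dist_eq_norm]
    linarith
  · refine (BoundedContinuousFunction.norm_le hε.le).2 fun x => ?_
    have hmx := hmΩ x x.2
    have e1 := (hψv (m x)).2
    rw [(hvu _ (mem_image_of_mem m x.2)).fderiv_eq, (hasFDerivAt_zeroExt_fn u hmx).fderiv,
      zeroExt_of_mem _ (subset_closure hmx), dist_eq_norm] at e1
    have e2 := (h₂ (a := ⟨m x, subset_closure hmx⟩) (b := x)
      ((hmdist x x.2).trans_le (min_le_right _ _))).le
    rw [dist_eq_norm] at e2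
    have hch : fderiv ℝ (ψ ∘ m) x = (1 - κ) • fderiv ℝ ψ (m x) := by
      have h := ((hψ.differentiable (by simp) (m x)).hasFDerivAt.comp (x : Euc d) (hmd x)).fderiv
      rw [h]
      ext
      simp
    change ‖fderiv ℝ (ψ ∘ m) x - der u x‖ ≤ ε
    -- Three errors of size `ε / 3`: mollification, displacement by `m`, and the factor `1 - κ`.
    have e3 : fderiv ℝ (ψ ∘ m) x - der u x
        = (1 - κ) • (fderiv ℝ ψ (m x) - der u ⟨m x, subset_closure hmx⟩)
          + (1 - κ) • (der u ⟨m x, subset_closure hmx⟩ - der u x) - κ • der u x := by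
      rw [hch]
      module
    have e4 : ‖κ • der u x‖ ≤ κ * ‖der u‖ := by
      rw [norm_smul, Real.norm_of_nonneg hκ0.le]
      gcongr
      exact (der u).norm_coe_le_norm x
    have hκn : ‖1 - κ‖ ≤ 1 := by
      rw [Real.norm_of_nonneg (by linarith)]
      linarith
    have e5 : ∀ A : Euc d →L[ℝ] ℝ, ‖(1 - κ) • A‖ ≤ ‖A‖ := fun A => by
      rw [norm_smul]
      exact mul_le_of_le_one_left (norm_nonneg _) hκn
    rw [e3]
    refine (norm_sub_le _ _).trans ((add_le_add_left (norm_add_le _ _) _).trans ?_)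
    have := e5 (fderiv ℝ ψ (m x) - der u ⟨m x, subset_closure hmx⟩)
    have := e5 (der u ⟨m x, subset_closure hmx⟩ - der u x)
    linarith

/-- `C([0,T]; C²(Ω̄))` is dense in `C([0,T]; C¹(Ω̄))`. -/
theorem denseRange_incl (hΩ : IsOpen Ω) (hconv : Convex ℝ Ω)
    (hbd : Bornology.IsBounded Ω) (hne : Ω.Nonempty) (T : ℝ) : DenseRange (incl T Ω) := by
  rw [Metric.denseRange_iff]
  intro φ ε hε
  -- A `C²` approximation at one time remains good at nearby times; the admissible sets are convex,
  -- so these constant choices glue to a continuous one.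
  obtain ⟨w, hw⟩ := exists_continuous_forall_mem_convex_of_local_const
    (X := Icc (0 : ℝ) T) (E := C2 Ω)
    (t := fun t => C2.toC1 Ω ⁻¹' Metric.ball (φ t) (ε / 2))
    (fun t => (convex_ball _ _).linear_preimage (C2.toC1 Ω).toLinearMap) (fun t => by
      obtain ⟨c, hc⟩ := exists_norm_toC1_sub_le hΩ hconv hbd hne (φ t) (ε := ε / 4) (by positivity)
      refine ⟨c, ?_⟩
      have hcont : ContinuousAt (fun s => dist (C2.toC1 Ω c) (φ s)) t := by fun_prop
      refine hcont.eventually (gt_mem_nhds ?_)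
      change dist (C2.toC1 Ω c) (φ t) < ε / 2
      rw [dist_eq_norm]
      linarith)
  refine ⟨w, ?_⟩
  rw [dist_comm]
  refine lt_of_le_of_lt ((ContinuousMap.dist_le (half_pos hε).le).2 fun t => (hw t).le)
    (half_lt_self hε)

end Density

/-! ### Global flow of the retracted field and its Lipschitz dependence on the data. -/

section Flow

open Filter

variable {d : ℕ} {Ω : Set (Euc d)} {T : ℝ}

/-- Composition with a continuous linear map, on `C([0,T]; C¹(Ω̄; F))`. -/
def CtC1.postcomp {F G : Type*} [NormedAddCommGroup F] [NormedSpace ℝ F]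
    [NormedAddCommGroup G] [NormedSpace ℝ G] (T : ℝ) (Ω : Set (Euc d)) (A : F →L[ℝ] G) :
    CtC1 T Ω F →L[ℝ] CtC1 T Ω G :=
  (C1.postcomp A).compLeftContinuous ℝ (Icc (0 : ℝ) T)

theorem val_postcomp {F G : Type*} [NormedAddCommGroup F] [NormedSpace ℝ F]
    [NormedAddCommGroup G] [NormedSpace ℝ G] (A : F →L[ℝ] G) (φ : CtC1 T Ω F) (t : ℝ) (x : Euc d) :
    val (CtC1.postcomp T Ω A φ) t x = A (val φ t x) := by
  by_cases ht : t ∈ Icc 0 T <;> by_cases hx : x ∈ closure Ω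
  · rw [val_apply _ ht hx, val_apply _ ht hx]
    exact fn_postcomp A _ _
  · simp [val, zeroExt, hx]
  · simp [val, zeroExt, ht, hx, fn_zero]
  · simp [val, zeroExt, hx]

/-- Uniform strict differentiability of `(w, x) ↦ (φ₀ + ι w)(t, x)` along a family of curves. -/
theorem uniform_expansion_val {X W : Type*} [NormedAddCommGroup X] [NormedSpace ℝ X]
    [NormedAddCommGroup W] [NormedSpace ℝ W] (hconv : Convex ℝ Ω) (hbd : Bornology.IsBounded Ω)
    (φ₀ : CtC1 T Ω W) (ι : X →L[ℝ] CtC1 T Ω W) {S : Set ℝ} (hS : S ⊆ Icc 0 T)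
    {z : ℝ × Euc d × X → ℝ → Euc d} {q₀ : ℝ × Euc d × X}
    (hzΩ : ∀ᶠ q in 𝓝 q₀, ∀ t ∈ S, z q t ∈ Ω) {K : ℝ}
    (hz : ∀ᶠ r : (ℝ × Euc d × X) × (ℝ × Euc d × X) in 𝓝 (q₀, q₀), ∀ t ∈ S,
      ‖z r.1 t - z r.2 t‖ ≤ K * ‖r.1 - r.2‖) :
    ∀ ε > 0, ∀ᶠ r : (ℝ × Euc d × X) × (ℝ × Euc d × X) in 𝓝 (q₀, q₀), ∀ t ∈ S,
      ‖val (φ₀ + ι r.1.2.2) t (z r.1 t) - val (φ₀ + ι r.2.2.2) t (z r.2 t)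
        - dval (φ₀ + ι q₀.2.2) t (z q₀ t) (z r.1 t - z r.2 t)
        - ((evalCLM T Ω W t (z q₀ t)).comp ι) (r.1.2.2 - r.2.2.2)‖ ≤ ε * ‖r.1 - r.2‖ := by
  intro ε hε
  have hη : 0 < ε / (|K| + ‖ι‖ + 1) := by positivity
  obtain ⟨δ, hδ, h⟩ := exists_norm_val_expansion_le hconv hbd (φ₀ + ι q₀.2.2) hη
  have hclose := eventually_norm_sub_lt_of_lipschitz hz hδ
  have hφ : ∀ᶠ q : ℝ × Euc d × X in 𝓝 q₀, ‖φ₀ + ι q.2.2 - (φ₀ + ι q₀.2.2)‖ < δ := by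
    have hc : ContinuousAt (fun q : ℝ × Euc d × X => ‖φ₀ + ι q.2.2 - (φ₀ + ι q₀.2.2)‖) q₀ := by
      fun_prop
    exact hc.eventually (gt_mem_nhds (by simpa using hδ))
  filter_upwards [hz, hzΩ.prod_inl_nhds q₀, hzΩ.prod_inr_nhds q₀, hclose.prod_inl_nhds q₀,
    hclose.prod_inr_nhds q₀, hφ.prod_inl_nhds q₀] with r h1 h2 h3 h4 h5 h6 t ht
  have e1 := h (φ₀ + ι r.1.2.2) (φ₀ + ι r.2.2.2) h6 t (hS ht) (z q₀ t) (hzΩ.self_of_nhds t ht)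
    (z r.1 t) (h2 t ht) (z r.2 t) (h3 t ht) (h4 t ht) (h5 t ht)
  have e2 : φ₀ + ι r.1.2.2 - (φ₀ + ι r.2.2.2) = ι (r.1.2.2 - r.2.2.2) := by
    rw [map_sub]
    abel
  rw [e2] at e1
  have e3 : ‖ι (r.1.2.2 - r.2.2.2)‖ ≤ ‖ι‖ * ‖r.1 - r.2‖ :=
    ι.le_of_opNorm_le_of_le le_rfl (norm_snd_snd_sub_le r)
  have e4 : ‖z r.1 t - z r.2 t‖ ≤ |K| * ‖r.1 - r.2‖ :=
    (h1 t ht).trans (mul_le_mul_of_nonneg_right (le_abs_self K) (norm_nonneg _))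
  refine e1.trans ?_
  calc ε / (|K| + ‖ι‖ + 1) * (‖z r.1 t - z r.2 t‖ + ‖ι (r.1.2.2 - r.2.2.2)‖)
      ≤ ε / (|K| + ‖ι‖ + 1) * ((|K| + ‖ι‖ + 1) * ‖r.1 - r.2‖) := by
        gcongr
        nlinarith [norm_nonneg (r.1 - r.2)]
    _ = ε * ‖r.1 - r.2‖ := by
        rw [← mul_assoc, div_mul_cancel₀ _ (by positivity)]

/-- The velocity `φ(t, π x)`, for a retraction `π` onto `Ω̄`, has a global flow on `[0,T]`. -/
theorem exists_global_flow {X : Type*} (hconv : Convex ℝ Ω) {π : Euc d → Euc d}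
    (hπ : LipschitzWith 1 π) (hπmem : ∀ x, π x ∈ closure Ω) (Ψ : X → CtC1 T Ω (Euc d)) :
    ∃ Y : ℝ × Euc d × X → ℝ → Euc d, ∀ q, q.1 ∈ Icc 0 T → Y q q.1 = q.2.1 ∧
      ∀ t ∈ Icc 0 T, HasDerivWithinAt (Y q) (val (Ψ q.2.2) t (π (Y q t))) (Icc 0 T) t := by
  have h : ∀ q : ℝ × Euc d × X, ∃ y : ℝ → Euc d, q.1 ∈ Icc 0 T → y q.1 = q.2.1 ∧
      ∀ t ∈ Icc 0 T, HasDerivWithinAt y (val (Ψ q.2.2) t (π (y t))) (Icc 0 T) t := by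
    intro q
    by_cases hq : q.1 ∈ Icc 0 T
    · have hlip : ∀ t ∈ Icc 0 T, LipschitzWith ‖Ψ q.2.2‖₊ fun x => val (Ψ q.2.2) t (π x) := by
        refine fun t ht => LipschitzWith.of_dist_le_mul fun x x' => ?_
        rw [dist_eq_norm]
        refine (norm_val_sub_le hconv _ ht (hπmem x) (hπmem x')).trans ?_
        rw [coe_nnnorm]
        gcongr
        simpa [dist_eq_norm] using hπ.dist_le_mul x x'
      obtain ⟨y, hy⟩ := exists_hasDerivWithinAt_of_bounded hlip
        (fun x => continuousOn_val_comp _ le_rfl continuousOn_const fun _ _ => hπmem x)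
        (fun t _ x => norm_val_le _ _ _) hq q.2.1
      exact ⟨y, fun _ => hy⟩
    · exact ⟨0, fun h => absurd h hq⟩
  choose Y hY using h
  exact ⟨Y, hY⟩

/-- Lipschitz dependence of the flow on the initial time, the initial value and the parameter. -/
theorem global_flow_lipschitz {X : Type*} [NormedAddCommGroup X] [NormedSpace ℝ X]
    (hconv : Convex ℝ Ω) {π : Euc d → Euc d}
    (hπ : LipschitzWith 1 π) (hπmem : ∀ x, π x ∈ closure Ω) (φ₀ : CtC1 T Ω (Euc d))
    (ι : X →L[ℝ] CtC1 T Ω (Euc d)) {Y : ℝ × Euc d × X → ℝ → Euc d}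
    (hY : ∀ q, q.1 ∈ Icc 0 T → Y q q.1 = q.2.1 ∧
      ∀ t ∈ Icc 0 T, HasDerivWithinAt (Y q) (val (φ₀ + ι q.2.2) t (π (Y q t))) (Icc 0 T) t)
    {q₀ : ℝ × Euc d × X} (hq₀ : q₀.1 ∈ Ioo 0 T) :
    ∃ K, ∀ᶠ r : (ℝ × Euc d × X) × (ℝ × Euc d × X) in 𝓝 (q₀, q₀), ∀ t ∈ Icc 0 T,
      ‖Y r.1 t - Y r.2 t‖ ≤ K * ‖r.1 - r.2‖ := by
  -- Near `q₀`, `N` bounds the `C¹` norm of the field, so it serves both as a speed bound and as a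
  -- Lipschitz constant.
  set N := ‖φ₀ + ι q₀.2.2‖ + 1 with hN
  have hN0 : 0 ≤ N := by positivity
  have hφ : ∀ᶠ q : ℝ × Euc d × X in 𝓝 q₀, ‖φ₀ + ι q.2.2‖ < N := by
    have hc : ContinuousAt (fun q : ℝ × Euc d × X => ‖φ₀ + ι q.2.2‖) q₀ := by
      fun_prop
    exact hc.eventually (gt_mem_nhds (lt_add_one _))
  have hmem : ∀ᶠ q in 𝓝 q₀, q.1 ∈ Icc 0 T :=
    continuousAt_fst.eventually (Icc_mem_nhds hq₀.1 hq₀.2)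
  refine ⟨(1 + N + ‖ι‖) * Real.exp ((N + 1) * (T - 0)), ?_⟩
  filter_upwards [hφ.prod_inl_nhds q₀, hφ.prod_inr_nhds q₀, hmem.prod_inl_nhds q₀,
    hmem.prod_inr_nhds q₀] with r h1 h2 h3 h4 t ht
  obtain ⟨hi1, hd1⟩ := hY r.1 h3
  obtain ⟨hi2, hd2⟩ := hY r.2 h4
  have hR := norm_nonneg (r.1 - r.2)
  have hinit : ‖Y r.1 r.1.1 - Y r.2 r.1.1‖ ≤ (1 + N) * ‖r.1 - r.2‖ := by
    have e1 : ‖Y r.2 r.1.1 - Y r.2 r.2.1‖ ≤ N * ‖r.1.1 - r.2.1‖ :=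
      (convex_Icc 0 T).norm_image_sub_le_of_norm_hasDerivWithin_le hd2
        (fun s _ => (norm_val_le _ _ _).trans h2.le) h4 h3
    have e2 := mul_le_mul_of_nonneg_left (norm_fst_sub_le r) hN0
    have e3 : Y r.1 r.1.1 - Y r.2 r.1.1
        = (r.1.2.1 - r.2.2.1) - (Y r.2 r.1.1 - Y r.2 r.2.1) := by
      rw [hi1, hi2]
      abel
    rw [e3]
    refine (norm_sub_le _ _).trans ?_
    rw [Real.norm_eq_abs] at e1
    linarith [norm_snd_fst_sub_le r]
  have hι : ‖ι (r.1.2.2 - r.2.2.2)‖ ≤ ‖ι‖ * ‖r.1 - r.2‖ :=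
    ι.le_of_opNorm_le_of_le le_rfl (norm_snd_snd_sub_le r)
  refine (norm_le_of_norm_deriv_le (e := fun t => Y r.1 t - Y r.2 t) hN0
    (ε := ‖ι‖ * ‖r.1 - r.2‖) (by positivity) (fun t ht => (hd1 t ht).sub (hd2 t ht)) ?_
    h3 ht).trans ?_
  · intro s hs
    have e1 := norm_val_sub_le hconv (φ₀ + ι r.1.2.2) hs (hπmem (Y r.1 s)) (hπmem (Y r.2 s))
    have e2 := norm_val_le (ι (r.1.2.2 - r.2.2.2)) s (π (Y r.2 s))
    have e3 : ‖π (Y r.1 s) - π (Y r.2 s)‖ ≤ ‖Y r.1 s - Y r.2 s‖ := by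
      simpa [dist_eq_norm] using hπ.dist_le_mul (Y r.1 s) (Y r.2 s)
    -- Same field at two points, plus two fields at the same point: the Lipschitz term and the
    -- inhomogeneity in Grönwall.
    have e4 : val (φ₀ + ι r.1.2.2) s (π (Y r.1 s)) - val (φ₀ + ι r.2.2.2) s (π (Y r.2 s))
        = (val (φ₀ + ι r.1.2.2) s (π (Y r.1 s)) - val (φ₀ + ι r.1.2.2) s (π (Y r.2 s)))
          + val (ι (r.1.2.2 - r.2.2.2)) s (π (Y r.2 s)) := by
      simp only [map_sub, val_sub, val_add]
      abel
    rw [e4]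
    refine (norm_add_le _ _).trans ?_
    have e5 := mul_le_mul h1.le e3 (norm_nonneg _) hN0
    linarith
  · rw [mul_right_comm]
    gcongr
    linarith

end Flow

/-! ### The feedback and the control as bounded linear functions of `v`. -/

namespace ControlProblem

variable {d M : ℕ} (P : ControlProblem d M)

/-- The linear map `w ↦ U_w`. -/
def feedback : CtC2 P.T P.Ω →L[ℝ] CtC1 P.T P.Ω (Euc M) :=
  (CtC1.postcomp P.T P.Ω ((-(1 / P.β)) • P.Bop.adjoint.comp (rieszSymm d))).comp
    ((C2.derivC1 P.Ω).compLeftContinuous ℝ (Icc (0 : ℝ) P.T))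

/-- The linear map `w ↦ B U_w`. -/
def control : CtC2 P.T P.Ω →L[ℝ] CtC1 P.T P.Ω (Euc d) :=
  (CtC1.postcomp P.T P.Ω P.Bop).comp P.feedback

/-- Here the second derivative of `v` enters: since `Dv` is itself an element of `C¹`, the feedback
is a `C¹` field in space. -/
theorem U_eq (v : CtC2 P.T P.Ω) (t : ℝ) : P.U v t = val (P.feedback v) t := by
  funext x
  have h : val ((C2.derivC1 P.Ω).compLeftContinuous ℝ (Icc (0 : ℝ) P.T) v) t x
      = dval (incl P.T P.Ω v) t x := by
    by_cases ht : t ∈ Icc 0 P.T <;> by_cases hx : x ∈ closure P.Ω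
    · rw [val_apply _ ht hx, dval_apply _ ht hx]
      exact congrArg (fun w => w ⟨x, hx⟩) (fn_derivC1 (v ⟨t, ht⟩))
    · simp [val, dval, zeroExt, hx]
    · simp [val, dval, zeroExt, ht, hx, fn_zero, der_zero]
    · simp [val, dval, zeroExt, hx]
  rw [feedback, ContinuousLinearMap.comp_apply, val_postcomp, h, U, grad_eq]
  rfl

theorem F_eq (v : CtC2 P.T P.Ω) (t : ℝ) : P.F v t = val (P.f + P.control v) t := by
  funext x
  rw [F, U_eq, val_add, control, ContinuousLinearMap.comp_apply, val_postcomp]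

theorem val_control (v : CtC2 P.T P.Ω) (t : ℝ) (x : Euc d) :
    val (P.control v) t x = P.Bop (P.U v t x) := by
  rw [control, ContinuousLinearMap.comp_apply, val_postcomp, U_eq]

/-- The terminal cost as a time-independent element of `C([0,T]; C¹(Ω̄))`. -/
def terminal : CtC1 P.T P.Ω ℝ := ContinuousMap.const _ P.g

theorem terminalCost_eq {t : ℝ} (ht : t ∈ Icc 0 P.T) : P.terminalCost = val P.terminal t := by
  funext x
  rw [val, zeroExt_of_mem _ ht]
  rfl

end ControlProblem

/-! ### The cost along the extended flow. -/

section FlowCost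

open Filter

variable {d : ℕ} {Ω : Set (Euc d)} {T : ℝ} {X : Type*} [NormedAddCommGroup X] [NormedSpace ℝ X]

/-- `Y (t₀, y₀, v)` is a solution on `[0,T]` of a globally Lipschitz extension of the initial value
problem `y' = (φ₀ + ι v)(t, y)`, `y(t₀) = y₀`. -/
structure IsFlow (φ₀ : CtC1 T Ω (Euc d)) (ι : X →L[ℝ] CtC1 T Ω (Euc d))
    (Y : ℝ × Euc d × X → ℝ → Euc d) : Prop where
  initial : ∀ q, q.1 ∈ Icc 0 T → Y q q.1 = q.2.1
  continuousOn : ∀ q, q.1 ∈ Icc 0 T → ContinuousOn (Y q) (Icc 0 T)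
  hasDerivWithinAt : ∀ q, q.1 ∈ Icc 0 T → ∀ t ∈ Icc 0 T, Y q t ∈ closure Ω →
    HasDerivWithinAt (Y q) (val (φ₀ + ι q.2.2) t (Y q t)) (Icc 0 T) t
  eqOn : ∀ q, q.1 ∈ Icc 0 T → ∀ y, y q.1 = q.2.1 → (∀ t ∈ Icc q.1 T, y t ∈ closure Ω ∧
    HasDerivWithinAt y (val (φ₀ + ι q.2.2) t (y t)) (Icc q.1 T) t) → ∀ t ∈ Icc q.1 T, y t = Y q t
  lipschitz : ∀ q₀, q₀.1 ∈ Ioo 0 T →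
    ∃ K, ∀ᶠ r : (ℝ × Euc d × X) × (ℝ × Euc d × X) in 𝓝 (q₀, q₀),
      ∀ t ∈ Icc 0 T, ‖Y r.1 t - Y r.2 t‖ ≤ K * ‖r.1 - r.2‖

/-- The field is evaluated at the nearest point of `Ω̄`, which changes nothing at points of `Ω̄`. A
solution with values in `Ω̄` therefore agrees with the extended flow by Grönwall. -/
theorem exists_isFlow (hconv : Convex ℝ Ω) (hne : Ω.Nonempty) (φ₀ : CtC1 T Ω (Euc d))
    (ι : X →L[ℝ] CtC1 T Ω (Euc d)) : ∃ Y, IsFlow φ₀ ι Y := by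
  obtain ⟨π, hπ, hπmem, hπid⟩ := exists_nonexpansive_retraction hne.closure isClosed_closure
    hconv.closure
  obtain ⟨Y, hY⟩ := exists_global_flow hconv hπ hπmem fun v : X => φ₀ + ι v
  refine ⟨Y, fun q hq => (hY q hq).1,
    fun q hq t ht => ((hY q hq).2 t ht).continuousWithinAt, fun q hq t ht hmem => ?_,
    fun q hq y hyi hy t ht => ?_, fun q₀ hq₀ => global_flow_lipschitz hconv hπ hπmem φ₀ ι hY hq₀⟩
  · have h := (hY q hq).2 t ht
    rwa [hπid _ hmem] at h
  · have hsub : Icc q.1 T ⊆ Icc 0 T := Icc_subset_Icc_left hq.1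
    have hbd : ∀ s ∈ Icc q.1 T, ‖val (φ₀ + ι q.2.2) s (y s) - val (φ₀ + ι q.2.2) s (π (Y q s))‖
        ≤ ‖φ₀ + ι q.2.2‖ * ‖y s - Y q s‖ + 0 := fun s hs => by
      rw [add_zero]
      refine (norm_val_sub_le hconv _ (hsub hs) (hy s hs).1 (hπmem _)).trans ?_
      gcongr
      have := hπ.dist_le_mul (y s) (Y q s)
      rw [hπid _ (hy s hs).1] at this
      simpa [dist_eq_norm] using this
    have h := norm_le_of_norm_deriv_le (e := fun t => y t - Y q t) (norm_nonneg _) le_rfl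
      (fun s hs => (hy s hs).2.sub (((hY q hq).2 s (hsub hs)).mono hsub)) hbd
      (left_mem_Icc.2 hq.2) ht
    simp only [hyi, (hY q hq).1, sub_self, norm_zero, add_zero, zero_mul] at h
    exact sub_eq_zero.1 (norm_le_zero_iff.1 h)

/-- The inhomogeneity of the adjoint equation along a curve `y`, for the running cost
`ℓ + β/2 |u|²`. -/
def adjointSource {M : ℕ} (β : ℝ) (ℓ : CtC1 T Ω ℝ) (u : CtC1 T Ω (Euc M)) (y : ℝ → Euc d) (t : ℝ) :
    Euc d :=
  rieszSymm d (dval ℓ t (y t)) + β • (dval u t (y t)).adjoint (val u t (y t))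

theorem inner_adjointSource {M : ℕ} (β : ℝ) (ℓ : CtC1 T Ω ℝ) (u : CtC1 T Ω (Euc M))
    (y : ℝ → Euc d) (t : ℝ) (e : Euc d) :
    inner ℝ (adjointSource β ℓ u y t) e
      = dval ℓ t (y t) e + β * inner ℝ (val u t (y t)) (dval u t (y t) e) := by
  rw [adjointSource, inner_add_left, ← grad_eq, inner_grad, real_inner_smul_left,
    ContinuousLinearMap.adjoint_inner_left]

theorem continuousOn_adjointSource {M : ℕ} (β : ℝ) (ℓ : CtC1 T Ω ℝ) (u : CtC1 T Ω (Euc M))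
    {y : ℝ → Euc d} {S : Set ℝ} (hS : S ⊆ Icc 0 T) (hy : ContinuousOn y S)
    (hmem : ∀ t ∈ S, y t ∈ closure Ω) : ContinuousOn (adjointSource β ℓ u y) S := by
  refine ((rieszSymm d).continuous.comp_continuousOn (continuousOn_dval_comp _ hS hy hmem)).add ?_
  refine ContinuousOn.const_smul ?_ β
  exact (ContinuousLinearMap.adjoint.continuous.comp_continuousOn
    (continuousOn_dval_comp _ hS hy hmem)).clm_apply (continuousOn_val_comp _ hS hy hmem)

namespace IsFlow

variable {φ₀ : CtC1 T Ω (Euc d)} {ι : X →L[ℝ] CtC1 T Ω (Euc d)} {Y : ℝ × Euc d × X → ℝ → Euc d}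

/-- Differentiation in the initial time compares earlier and later starts, so the curve must stay in
`Ω` slightly before `q.1` as well. -/
theorem exists_backward (hY : IsFlow φ₀ ι Y) (hΩ : IsOpen Ω)
    {q : ℝ × Euc d × X} (hq : q.1 ∈ Ioo 0 T) (hmem : ∀ t ∈ Icc q.1 T, Y q t ∈ Ω) :
    ∃ a, 0 ≤ a ∧ a < q.1 ∧ ∀ t ∈ Icc a T, Y q t ∈ Ω := by
  have hc : ContinuousAt (Y q) q.1 :=
    (hY.continuousOn q (Ioo_subset_Icc_self hq)).continuousAt (Icc_mem_nhds hq.1 hq.2)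
  have hev := hc.eventually (hΩ.mem_nhds (hmem q.1 (left_mem_Icc.2 hq.2.le)))
  obtain ⟨δ, hδ, h⟩ := Metric.eventually_nhds_iff.1 hev
  refine ⟨max 0 (q.1 - δ / 2), le_max_left _ _, max_lt hq.1 (by linarith), fun t ht => ?_⟩
  rcases le_total q.1 t with h1 | h1
  · exact hmem t ⟨h1, ht.2⟩
  · refine h ?_
    have := (le_max_right _ _).trans ht.1
    rw [Real.dist_eq, abs_sub_comm, abs_of_nonneg (by linarith)]
    linarith

/-- The base curve is compact, so a whole tube around it lies in `Ω`, and nearby curves stay in the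
tube. -/
theorem eventually_mem (hY : IsFlow φ₀ ι Y) (hΩ : IsOpen Ω) {q₀ : ℝ × Euc d × X} {a : ℝ}
    (ha : 0 ≤ a) (hq₀ : q₀.1 ∈ Ioo a T) (hmem : ∀ t ∈ Icc a T, Y q₀ t ∈ Ω) :
    ∀ᶠ q in 𝓝 q₀, ∀ t ∈ Icc a T, Y q t ∈ Ω := by
  have hq₀' : q₀.1 ∈ Ioo 0 T := ⟨ha.trans_lt hq₀.1, hq₀.2⟩
  obtain ⟨K, hK⟩ := hY.lipschitz q₀ hq₀'
  have hcomp : IsCompact (Y q₀ '' Icc a T) := isCompact_Icc.image_of_continuousOn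
    ((hY.continuousOn q₀ (Ioo_subset_Icc_self hq₀')).mono (Icc_subset_Icc_left ha))
  obtain ⟨ρ, hρ, hsub⟩ := hcomp.exists_thickening_subset_open hΩ (image_subset_iff.2 hmem)
  filter_upwards [eventually_norm_sub_lt_of_lipschitz hK hρ] with q hq t ht
  refine hsub (Metric.mem_thickening_iff.2 ⟨Y q₀ t, mem_image_of_mem _ ht, ?_⟩)
  rw [dist_eq_norm]
  exact hq t ⟨ha.trans ht.1, ht.2⟩

theorem norm_evalCLM_comp_le {W : Type*} [NormedAddCommGroup W] [NormedSpace ℝ W]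
    (κ : X →L[ℝ] CtC1 T Ω W) (t : ℝ) (x : Euc d) : ‖(evalCLM T Ω W t x).comp κ‖ ≤ ‖κ‖ :=
  (ContinuousLinearMap.opNorm_comp_le _ _).trans
    (mul_le_of_le_one_left (norm_nonneg _) (norm_evalCLM_le t x))

/-- Uniform strict differentiability of the running cost `ℓ + β/2 |u|²`, where `u = υ v`. -/
theorem uniform_expansion_runningCost {M : ℕ} (hconv : Convex ℝ Ω) (hbd : Bornology.IsBounded Ω)
    {β : ℝ} (hβ : 0 < β) (ℓ : CtC1 T Ω ℝ) (υ : X →L[ℝ] CtC1 T Ω (Euc M)) {S : Set ℝ}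
    (hS : S ⊆ Icc 0 T) {q₀ : ℝ × Euc d × X} {z : ℝ × Euc d × X → ℝ → Euc d}
    (hΩ : ∀ᶠ q in 𝓝 q₀, ∀ t ∈ S, z q t ∈ Ω) {K : ℝ}
    (hz : ∀ᶠ r : (ℝ × Euc d × X) × (ℝ × Euc d × X) in 𝓝 (q₀, q₀), ∀ t ∈ S,
      ‖z r.1 t - z r.2 t‖ ≤ K * ‖r.1 - r.2‖) :
    ∀ ε > 0, ∀ᶠ r : (ℝ × Euc d × X) × (ℝ × Euc d × X) in 𝓝 (q₀, q₀), ∀ t ∈ S,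
      |(val ℓ t (z r.1 t) + β / 2 * ‖val (υ r.1.2.2) t (z r.1 t)‖ ^ 2)
        - (val ℓ t (z r.2 t) + β / 2 * ‖val (υ r.2.2.2) t (z r.2 t)‖ ^ 2)
        - inner ℝ (adjointSource β ℓ (υ q₀.2.2) (z q₀) t) (z r.1 t - z r.2 t)
        - (β • (innerSL ℝ (val (υ q₀.2.2) t (z q₀ t))).comp
          ((evalCLM T Ω (Euc M) t (z q₀ t)).comp υ)) (r.1.2.2 - r.2.2.2)| ≤ ε * ‖r.1 - r.2‖ := by
  -- The general expansion is used with zero parameter map for `ℓ`, and with zero base field for the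
  -- feedback.
  have hexpl := uniform_expansion_val hconv hbd ℓ (0 : X →L[ℝ] CtC1 T Ω ℝ) hS hΩ hz
  have hexpU := uniform_expansion_val hconv hbd 0 υ hS hΩ hz
  simp only [zero_apply, add_zero, ContinuousLinearMap.comp_zero, sub_zero]
    at hexpl
  simp only [zero_add] at hexpU
  have hexpU2 := uniform_expansion_norm_sq (S := S) (z := z) (q₀ := q₀)
    (k := fun q t => val (υ q.2.2) t (z q t)) (n := ‖υ q₀.2.2‖) (m := ‖υ‖) (N := ‖υ q₀.2.2‖)
    (A := fun t => dval (υ q₀.2.2) t (z q₀ t))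
    (C := fun t => (evalCLM T Ω (Euc M) t (z q₀ t)).comp υ)
    (fun t _ => norm_dval_le (υ q₀.2.2) t (z q₀ t))
    (fun t _ => norm_evalCLM_comp_le υ t (z q₀ t))
    (fun t _ => norm_val_le (υ q₀.2.2) t (z q₀ t)) hz hexpU
  intro ε hε
  have h1 : 0 < ε / 2 := half_pos hε
  have h2 : 0 < ε / β := div_pos hε hβ
  filter_upwards [hexpl _ h1, hexpU2 _ h2] with r hr1 hr2 t ht
  have e1 := hr1 t ht
  have e2 := hr2 t ht
  rw [Real.norm_eq_abs] at e1
  have e4 : |β / 2 * _| ≤ _ := (abs_mul _ _).trans_le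
    (mul_le_mul_of_nonneg_left e2 (abs_nonneg (β / 2)))
  have e5 : β / 2 * (ε / β * ‖r.1 - r.2‖) = ε / 2 * ‖r.1 - r.2‖ := by
    field_simp
  have e6 : (β • (innerSL ℝ (val (υ q₀.2.2) t (z q₀ t))).comp
        ((evalCLM T Ω (Euc M) t (z q₀ t)).comp υ)) (r.1.2.2 - r.2.2.2)
      = β * inner ℝ (val (υ q₀.2.2) t (z q₀ t))
        (((evalCLM T Ω (Euc M) t (z q₀ t)).comp υ) (r.1.2.2 - r.2.2.2)) := by
    rw [smul_apply, ContinuousLinearMap.comp_apply, innerSL_apply_apply,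
      smul_eq_mul]
  rw [inner_adjointSource, e6]
  rw [abs_of_pos (half_pos hβ), e5] at e4
  have e7 := (abs_add_le _ _).trans (add_le_add e1 e4)
  rw [show ε / 2 * ‖r.1 - r.2‖ + ε / 2 * ‖r.1 - r.2‖ = ε * ‖r.1 - r.2‖ by ring] at e7
  rw [abs_le] at e7 ⊢
  constructor
  · linarith only [e7.1]
  · linarith only [e7.2]

theorem hasStrictFDerivAt_cost (hY : IsFlow φ₀ ι Y) (hΩo : IsOpen Ω) (hconv : Convex ℝ Ω)
    (hbd : Bornology.IsBounded Ω) {M : ℕ} {β : ℝ} (hβ : 0 < β) (ℓ g : CtC1 T Ω ℝ)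
    (υ : X →L[ℝ] CtC1 T Ω (Euc M))
    {q₀ : ℝ × Euc d × X} {a : ℝ} (ha : 0 ≤ a) (hq₀ : q₀.1 ∈ Ioo a T)
    (hmem : ∀ t ∈ Icc a T, Y q₀ t ∈ Ω) {p : ℝ → Euc d}
    (hp : ∀ t ∈ Icc a T, HasDerivWithinAt p (adjointSource β ℓ (υ q₀.2.2) (Y q₀) t
      - (dval (φ₀ + ι q₀.2.2) t (Y q₀ t)).adjoint (p t)) (Icc a T) t)
    (hpT : p T = -rieszSymm d (dval g T (Y q₀ T)))
    {Lx : X →L[ℝ] ℝ} (hLx : ∀ φ, Lx φ = ∫ t in q₀.1..T,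
      (β * inner ℝ (val (υ q₀.2.2) t (Y q₀ t)) (val (υ φ) t (Y q₀ t))
        - inner ℝ (p t) (val (ι φ) t (Y q₀ t)))) :
    HasStrictFDerivAt (fun q : ℝ × Euc d × X => (∫ t in q.1..T,
        (val ℓ t (Y q t) + β / 2 * ‖val (υ q.2.2) t (Y q t)‖ ^ 2)) + val g T (Y q T))
      (costDeriv (p q₀.1) (val (φ₀ + ι q₀.2.2) q₀.1 (Y q₀ q₀.1))
        (val ℓ q₀.1 (Y q₀ q₀.1) + β / 2 * ‖val (υ q₀.2.2) q₀.1 (Y q₀ q₀.1)‖ ^ 2) Lx) q₀ := by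
  have hq₀' : q₀.1 ∈ Ioo 0 T := ⟨ha.trans_lt hq₀.1, hq₀.2⟩
  have hS : Icc a T ⊆ Icc 0 T := Icc_subset_Icc_left ha
  have haT : a ≤ T := (hq₀.1.trans hq₀.2).le
  have hΩ := hY.eventually_mem hΩo ha hq₀ hmem
  have htime' : ∀ᶠ q : ℝ × Euc d × X in 𝓝 q₀, q.1 ∈ Icc 0 T :=
    continuousAt_fst.eventually (Icc_mem_nhds hq₀'.1 hq₀'.2)
  obtain ⟨K, hK⟩ := hY.lipschitz q₀ hq₀'
  have hz : ∀ᶠ r : (ℝ × Euc d × X) × (ℝ × Euc d × X) in 𝓝 (q₀, q₀),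
      ∀ t ∈ Icc a T, ‖Y r.1 t - Y r.2 t‖ ≤ K * ‖r.1 - r.2‖ :=
    hK.mono fun r hr t ht => hr t (hS ht)
  have hYc : ∀ q : ℝ × Euc d × X, q.1 ∈ Icc 0 T → ContinuousOn (Y q) (Icc a T) :=
    fun q hq => (hY.continuousOn q hq).mono hS
  have hcl : ∀ t ∈ Icc a T, Y q₀ t ∈ closure Ω := fun t ht => subset_closure (hmem t ht)
  have hYc0 := hYc q₀ (Ioo_subset_Icc_self hq₀')
  have hexpF := uniform_expansion_val hconv hbd φ₀ ι hS hΩ hz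
  have hexpg := uniform_expansion_val hconv hbd g (0 : X →L[ℝ] CtC1 T Ω ℝ) hS hΩ hz
  simp only [zero_apply, add_zero, ContinuousLinearMap.comp_zero, sub_zero]
    at hexpg
  have hmc : ∀ t ∈ Icc a T, ‖β • (innerSL ℝ (val (υ q₀.2.2) t (Y q₀ t))).comp
      ((evalCLM T Ω (Euc M) t (Y q₀ t)).comp υ)‖ ≤ β * (‖υ q₀.2.2‖ * ‖υ‖) := by
    intro t _
    rw [norm_smul, Real.norm_of_nonneg hβ.le]
    refine mul_le_mul_of_nonneg_left ((ContinuousLinearMap.opNorm_comp_le _ _).trans ?_) hβ.le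
    rw [innerSL_apply_norm]
    exact mul_le_mul (norm_val_le _ _ _) (norm_evalCLM_comp_le _ _ _) (norm_nonneg _)
      (norm_nonneg _)
  have hG : (fun r : (ℝ × Euc d × X) × (ℝ × Euc d × X) =>
      val g T (Y r.1 T) - val g T (Y r.2 T)
        - inner ℝ (rieszSymm d (dval g T (Y q₀ T))) (Y r.1 T - Y r.2 T))
      =o[𝓝 (q₀, q₀)] fun r => r.1 - r.2 := by
    rw [Asymptotics.isLittleO_iff]
    intro ε hε
    filter_upwards [hexpg ε hε] with r hr
    have := hr T (right_mem_Icc.2 haT)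
    rwa [← grad_eq, inner_grad]
  exact FeedbackLearning.hasStrictFDerivAt_cost hq₀
    (z := Y) (F := fun q t => val (φ₀ + ι q.2.2) t (Y q t))
    (h := fun q t => val ℓ t (Y q t) + β / 2 * ‖val (υ q.2.2) t (Y q t)‖ ^ 2)
    (G := fun q => val g T (Y q T))
    (A := fun t => dval (φ₀ + ι q₀.2.2) t (Y q₀ t))
    (b := adjointSource β ℓ (υ q₀.2.2) (Y q₀)) (p := p)
    (C := fun t => (evalCLM T Ω (Euc d) t (Y q₀ t)).comp ι)
    (c := fun t => β • (innerSL ℝ (val (υ q₀.2.2) t (Y q₀ t))).comp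
      ((evalCLM T Ω (Euc M) t (Y q₀ t)).comp υ))
    (γ := rieszSymm d (dval g T (Y q₀ T))) (Lx := Lx)
    (mC := ‖ι‖) (K := K)
    (htime'.mono fun q hq => hY.initial q hq)
    ((hΩ.and htime').mono fun q hq t ht =>
      (hY.hasDerivWithinAt q hq.2 t (hS ht) (subset_closure (hq.1 t ht))).mono hS)
    ((hΩ.and htime').mono fun q hq => continuousOn_val_comp _ hS (hYc q hq.2)
      fun t ht => subset_closure (hq.1 t ht))
    ((hΩ.and htime').mono fun q hq =>
      (continuousOn_val_comp _ hS (hYc q hq.2) fun t ht => subset_closure (hq.1 t ht)).add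
        (continuousOn_const.mul ((continuousOn_val_comp _ hS (hYc q hq.2)
          fun t ht => subset_closure (hq.1 t ht)).norm.pow 2)))
    (continuousOn_dval_comp _ hS hYc0 hcl)
    (continuousOn_adjointSource _ _ _ hS hYc0 hcl)
    (fun φ => continuousOn_val_comp (ι φ) hS hYc0 hcl)
    (fun φ => continuousOn_const.mul ((continuousOn_val_comp (υ q₀.2.2) hS hYc0 hcl).inner
      (continuousOn_val_comp (υ φ) hS hYc0 hcl)))
    (fun t _ => norm_evalCLM_comp_le ι t (Y q₀ t)) hmc hexpF
    (uniform_expansion_runningCost hconv hbd hβ ℓ υ hS hΩ hz) hG hz hp hpT hLx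

end IsFlow

end FlowCost

/-! ### The gradient functional, the adjoint equation and the feedback identity. -/

open Filter

/-- Only first derivatives of `φ` along a fixed curve occur, so the `C¹` norm controls the integral.
This supplies the extension of `D_v 𝒱`. -/
theorem exists_gradient_functional {d : ℕ} {Ω : Set (Euc d)} {s T : ℝ} (hs : 0 ≤ s) (hsT : s ≤ T)
    {y k : ℝ → Euc d} (hy : ContinuousOn y (Icc s T)) (hmem : ∀ t ∈ Icc s T, y t ∈ closure Ω)
    (hk : ContinuousOn k (Icc s T)) (c : ℝ) :
    ∃ L : CtC1 T Ω ℝ →L[ℝ] ℝ, ∀ φ, L φ = c * ∫ t in s..T, inner ℝ (grad φ t (y t)) (k t) := by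
  have hS : Icc s T ⊆ Icc 0 T := Icc_subset_Icc_left hs
  obtain ⟨m, hm⟩ := isCompact_Icc.exists_bound_of_continuousOn hk
  have hm0 : 0 ≤ m := (norm_nonneg _).trans (hm s (left_mem_Icc.2 hsT))
  have hint : ∀ φ : CtC1 T Ω ℝ, IntervalIntegrable (fun t => inner ℝ (grad φ t (y t)) (k t))
      MeasureTheory.volume s T := fun φ => by
    refine ContinuousOn.intervalIntegrable ?_
    rw [uIcc_of_le hsT]
    exact ((rieszSymm d).continuous.comp_continuousOn
      (continuousOn_dval_comp φ hS hy hmem)).inner hk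
  have hadd : ∀ (φ ψ : CtC1 T Ω ℝ), ∀ t ∈ Icc s T,
      grad (φ + ψ) t (y t) = grad φ t (y t) + grad ψ t (y t) := fun φ ψ t ht => by
    simp only [grad_eq, dval_apply _ (hS ht) (hmem t ht), ← map_add]
    rfl
  have hsmul : ∀ (a : ℝ) (φ : CtC1 T Ω ℝ), ∀ t ∈ Icc s T,
      grad (a • φ) t (y t) = a • grad φ t (y t) := fun a φ t ht => by
    simp only [grad_eq, dval_apply _ (hS ht) (hmem t ht), ← map_smul]
    rfl
  refine ⟨LinearMap.mkContinuous
    { toFun := fun φ => c * ∫ t in s..T, inner ℝ (grad φ t (y t)) (k t)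
      map_add' := fun φ ψ => ?_
      map_smul' := fun a φ => ?_ } (|c| * (m * |T - s|)) fun φ => ?_, fun φ => rfl⟩
  · rw [← mul_add, ← intervalIntegral.integral_add (hint φ) (hint ψ)]
    refine congrArg (c * ·) (intervalIntegral.integral_congr fun t ht => ?_)
    rw [uIcc_of_le hsT] at ht
    simp only [hadd φ ψ t ht, inner_add_left]
  · rw [RingHom.id_apply, smul_eq_mul, mul_left_comm, ← intervalIntegral.integral_const_mul a]
    refine congrArg (c * ·) (intervalIntegral.integral_congr fun t ht => ?_)
    rw [uIcc_of_le hsT] at ht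
    simp only [hsmul a φ t ht, real_inner_smul_left]
  · change ‖c * ∫ t in s..T, inner ℝ (grad φ t (y t)) (k t)‖ ≤ _
    rw [norm_mul, Real.norm_eq_abs, mul_assoc]
    refine mul_le_mul_of_nonneg_left ?_ (abs_nonneg c)
    refine (intervalIntegral.norm_integral_le_of_norm_le_const
      (C := m * ‖φ‖) fun t ht => ?_).trans_eq (by ring)
    rw [uIoc_of_le hsT] at ht
    rw [mul_comm m]
    exact (norm_inner_le_norm (𝕜 := ℝ) _ _).trans (mul_le_mul (norm_grad_le φ t _)
      (hm t (Ioc_subset_Icc_self ht)) (norm_nonneg _) (norm_nonneg _))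

/-- The adjoint equation in terms of the extended derivatives of the data. -/
theorem adjoint_equation_iff {d M : ℕ} {Ω : Set (Euc d)} {s T β : ℝ} (w : CtC1 T Ω (Euc d))
    (ℓ : CtC1 T Ω ℝ) (u : CtC1 T Ω (Euc M)) (h : CtC1 T Ω ℝ) {y p : ℝ → Euc d}
    (hs : s ∈ Ico 0 T) (hyc : ContinuousOn y (Icc s T)) (hmem : ∀ t ∈ Icc s T, y t ∈ Ω) :
    (ContDiffOn ℝ 1 p (Icc s T) ∧
      (∀ t ∈ Icc s T, -derivWithin p (Icc s T) t - (fderiv ℝ (val w t) (y t)).adjoint (p t) =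
        -gradient (val ℓ t) (y t)
          - β • (fderiv ℝ (val u t) (y t)).adjoint (val u t (y t))) ∧
      p T = -gradient (val h T) (y T)) ↔
    (∀ t ∈ Icc s T, HasDerivWithinAt p
        (adjointSource β ℓ u y t - (dval w t (y t)).adjoint (p t)) (Icc s T) t) ∧
      p T = -rieszSymm d (dval h T (y T)) := by
  have hT : T ∈ Icc s T := right_mem_Icc.2 hs.2.le
  have hS : Icc s T ⊆ Icc 0 T := Icc_subset_Icc_left hs.1
  have hcl : ∀ t ∈ Icc s T, y t ∈ closure Ω := fun t ht => subset_closure (hmem t ht)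
  have hud : UniqueDiffOn ℝ (Icc s T) := uniqueDiffOn_Icc hs.2
  have hgrad : ∀ (ψ : CtC1 T Ω ℝ), ∀ t ∈ Icc s T,
      gradient (val ψ t) (y t) = rieszSymm d (dval ψ t (y t)) := fun ψ t ht => by
    rw [gradient, (hasFDerivAt_val ψ t (hmem t ht)).fderiv, rieszSymm_apply]
  have hvec : ∀ e x₁ x₂ x₃ : Euc d, -e - x₁ = -x₂ - x₃ ↔ e = x₂ + x₃ - x₁ :=
    fun e x₁ x₂ x₃ => ⟨fun h => by
      rw [← neg_inj, ← sub_left_inj (a := x₁)]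
      exact h.trans (by abel), fun h => by
      rw [h]
      abel⟩
  have heq : ∀ t ∈ Icc s T, ∀ e : Euc d,
      (-e - (fderiv ℝ (val w t) (y t)).adjoint (p t) = -gradient (val ℓ t) (y t)
        - β • (fderiv ℝ (val u t) (y t)).adjoint (val u t (y t))) ↔
      e = adjointSource β ℓ u y t - (dval w t (y t)).adjoint (p t) := by
    intro t ht e
    rw [(hasFDerivAt_val w t (hmem t ht)).fderiv, (hasFDerivAt_val u t (hmem t ht)).fderiv,
      hgrad ℓ t ht]
    exact hvec _ _ _ _
  rw [hgrad h T hT]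
  constructor
  · rintro ⟨h1, h2, h3⟩
    refine ⟨fun t ht => ?_, h3⟩
    rw [← (heq t ht _).1 (h2 t ht)]
    exact (h1.differentiableOn one_ne_zero t ht).hasDerivWithinAt
  · rintro ⟨h1, h3⟩
    have hpc : ContinuousOn p (Icc s T) := fun t ht => (h1 t ht).continuousWithinAt
    have hd : ∀ t ∈ Icc s T, derivWithin p (Icc s T) t
        = adjointSource β ℓ u y t - (dval w t (y t)).adjoint (p t) := fun t ht =>
      (h1 t ht).derivWithin (hud t ht)
    refine ⟨(contDiffOn_one_iff_derivWithin hud).2 ⟨fun t ht => (h1 t ht).differentiableWithinAt,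
      ContinuousOn.congr ?_ hd⟩, fun t ht => (heq t ht _).2 (hd t ht), h3⟩
    exact (continuousOn_adjointSource β ℓ u hS hyc hcl).sub
      ((ContinuousLinearMap.adjoint.continuous.comp_continuousOn
        (continuousOn_dval_comp w hS hyc hcl)).clm_apply hpc)

/-- Solutions of the adjoint equation are unique. -/
theorem adjoint_unique {s T : ℝ} {A : ℝ → Euc d →L[ℝ] Euc d} {b p p' : ℝ → Euc d}
    {K : ℝ} (hK : ∀ t ∈ Icc s T, ‖A t‖ ≤ K)
    (hp : ∀ t ∈ Icc s T, HasDerivWithinAt p (b t - (A t).adjoint (p t)) (Icc s T) t)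
    (hp' : ∀ t ∈ Icc s T, HasDerivWithinAt p' (b t - (A t).adjoint (p' t)) (Icc s T) t)
    (hT : p' T = p T) : EqOn p' p (Icc s T) := by
  intro t ht
  have hsT : s ≤ T := ht.1.trans ht.2
  have hK0 : 0 ≤ K := (norm_nonneg _).trans (hK t ht)
  have hbd : ∀ u ∈ Icc s T, ‖b u - (A u).adjoint (p' u) - (b u - (A u).adjoint (p u))‖
      ≤ K * ‖p' u - p u‖ + 0 := fun u hu => by
    rw [sub_sub_sub_cancel_left, ← map_sub, add_zero, norm_sub_rev (p' u)]
    refine ContinuousLinearMap.le_of_opNorm_le _ ?_ _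
    rw [LinearIsometryEquiv.norm_map]
    exact hK u hu
  have h := norm_le_of_norm_deriv_le (e := fun t => p' t - p t) hK0 le_rfl
    (fun u hu => (hp' u hu).sub (hp u hu)) hbd (right_mem_Icc.2 hsT) ht
  simp only [hT, sub_self, norm_zero, add_zero, zero_mul] at h
  exact sub_eq_zero.1 (norm_le_zero_iff.1 h)

/-- The two factors `-1/β` against the weight `β` give `(1/β)⟨B*b, B*a⟩`; the signs in the costate
term cancel to give `(1/β)⟨B*p, B*a⟩`. -/
theorem inner_feedback_eq {E₁ E₂ : Type*} [NormedAddCommGroup E₁] [InnerProductSpace ℝ E₁]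
    [CompleteSpace E₁] [NormedAddCommGroup E₂] [InnerProductSpace ℝ E₂] [CompleteSpace E₂]
    (B : E₁ →L[ℝ] E₂) {β : ℝ} (hβ : β ≠ 0) (a b p : E₂) :
    β * inner ℝ (-(1 / β) • B.adjoint b) (-(1 / β) • B.adjoint a)
        - inner ℝ p (B (-(1 / β) • B.adjoint a))
      = 1 / β * inner ℝ a (B (B.adjoint (b + p))) := by
  rw [← ContinuousLinearMap.adjoint_inner_left, ← ContinuousLinearMap.adjoint_inner_left, map_add,
    inner_add_right, real_inner_smul_left, real_inner_smul_right, real_inner_smul_right,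
    real_inner_comm (B.adjoint a) (B.adjoint b), real_inner_comm (B.adjoint a) (B.adjoint p)]
  field_simp
  ring

/-! ### Closed-loop trajectories and the cost in terms of the extended flow. -/

namespace ControlProblem

variable {d M : ℕ} (P : ControlProblem d M)

/-- `ℛ(v)` records only times before `T`; the endpoint is a limit of such states, which is why the
closure of `ℛ(v)` is needed. -/
theorem trajectory_mem {t₀ : ℝ} {y₀ : Euc d} {v : CtC2 P.T P.Ω} (ht₀ : t₀ ∈ Ioo 0 P.T)
    (hy₀ : y₀ ∈ P.ω) (hv : v ∈ P.D) {y : ℝ → Euc d} (hyc : ContinuousOn y (Icc t₀ P.T))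
    (hΦ : ∀ t ∈ Icc t₀ P.T, P.Φ t₀ y₀ v t = y t) : ∀ t ∈ Icc t₀ P.T, y t ∈ P.Ω := by
  have hIco : MapsTo y (Ico t₀ P.T) (P.R v) := fun t ht =>
    ⟨t, ⟨ht₀.1.trans_le ht.1, ht.2⟩, t₀, ht₀, y₀, hy₀, ht, (hΦ t (Ico_subset_Icc_self ht)).symm⟩
  have hcl : closure (Ico t₀ P.T) = Icc t₀ P.T := closure_Ico ht₀.2.ne
  intro t ht
  refine hv.2 (((hyc t ht).mono Ico_subset_Icc_self).mem_closure ?_ hIco)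
  rwa [hcl]

variable {P}

theorem Φ_eq {Y : ℝ × Euc d × CtC2 P.T P.Ω → ℝ → Euc d}
    (hY : IsFlow (X := CtC2 P.T P.Ω) P.f P.control Y)
    {t₀ : ℝ} {y₀ : Euc d} {v : CtC2 P.T P.Ω} (ht₀ : t₀ ∈ Icc 0 P.T)
    (h : ∃ y, P.IsTrajectory v t₀ y₀ y) {t : ℝ} (ht : t ∈ Icc t₀ P.T) :
    P.Φ t₀ y₀ v t = Y (t₀, y₀, v) t := by
  rw [Φ, dif_pos h, if_pos ht.1]
  refine hY.eqOn (t₀, y₀, v) ht₀ _ h.choose_spec.1 (fun s hs => ?_) t ht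
  have h2 := h.choose_spec.2 s hs
  rwa [F_eq] at h2

/-- Provides trajectories for perturbed data that are not known to belong to `ω` or `𝒟`. -/
theorem isTrajectory_of_isFlow {Y : ℝ × Euc d × CtC2 P.T P.Ω → ℝ → Euc d}
    (hY : IsFlow (X := CtC2 P.T P.Ω) P.f P.control Y) {t₀ : ℝ} {y₀ : Euc d} {v : CtC2 P.T P.Ω}
    (ht₀ : t₀ ∈ Icc 0 P.T)
    (h : ∀ t ∈ Icc t₀ P.T, Y (t₀, y₀, v) t ∈ closure P.Ω) :
    P.IsTrajectory v t₀ y₀ (Y (t₀, y₀, v)) := by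
  have hsub : Icc t₀ P.T ⊆ Icc 0 P.T := Icc_subset_Icc_left ht₀.1
  refine ⟨hY.initial _ ht₀, fun t ht => ⟨h t ht, ?_⟩⟩
  rw [F_eq]
  exact (hY.hasDerivWithinAt _ ht₀ t (hsub ht) (h t ht)).mono hsub

theorem V_eq {t₀ : ℝ} {y₀ : Euc d} {v : CtC2 P.T P.Ω} {y : ℝ → Euc d} (ht₀ : t₀ ∈ Icc 0 P.T)
    (hy : ∀ t ∈ Icc t₀ P.T, P.Φ t₀ y₀ v t = y t) :
    P.V t₀ y₀ v = (∫ t in t₀..P.T,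
        (val P.ℓ t (y t) + P.β / 2 * ‖val (P.feedback v) t (y t)‖ ^ 2))
      + val P.terminal P.T (y P.T) := by
  rw [V, P.terminalCost_eq (right_mem_Icc.2 P.T_pos.le), hy _ (right_mem_Icc.2 ht₀.2)]
  congr 1
  refine intervalIntegral.integral_congr fun t ht => ?_
  rw [uIcc_of_le ht₀.2] at ht
  simp only [hy t ht, U_eq]

set_option maxHeartbeats 2000000 in
theorem isAdjointState_iff {t₀ : ℝ} {y₀ : Euc d} {v : CtC2 P.T P.Ω} {y p : ℝ → Euc d}
    (hs : t₀ ∈ Ico 0 P.T) (hyc : ContinuousOn y (Icc t₀ P.T))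
    (hy : ∀ t ∈ Icc t₀ P.T, P.Φ t₀ y₀ v t = y t) (hmem : ∀ t ∈ Icc t₀ P.T, y t ∈ P.Ω) :
    P.IsAdjointState t₀ y₀ v p ↔
      (∀ t ∈ Icc t₀ P.T, HasDerivWithinAt p (adjointSource P.β P.ℓ (P.feedback v) y t
        - (dval (P.f + P.control v) t (y t)).adjoint (p t)) (Icc t₀ P.T) t) ∧
      p P.T = -rieszSymm d (dval P.terminal P.T (y P.T)) := by
  rw [← adjoint_equation_iff (P.f + P.control v) P.ℓ (P.feedback v) P.terminal hs hyc hmem,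
    IsAdjointState, P.terminalCost_eq (right_mem_Icc.2 P.T_pos.le),
    hy _ (right_mem_Icc.2 hs.2.le)]
  refine and_congr_right' (and_congr_left' (forall₂_congr fun t ht => ?_))
  rw [hy t ht, F_eq, U_eq]

end ControlProblem

open Filter

namespace ControlProblem

variable {d M : ℕ} {P : ControlProblem d M}

theorem inner_control_eq (v φ : CtC2 P.T P.Ω) (t : ℝ) (x p : Euc d) :
    P.β * inner ℝ (val (P.feedback v) t x) (val (P.feedback φ) t x)
        - inner ℝ p (val (P.control φ) t x)
      = 1 / P.β * inner ℝ (grad (incl P.T P.Ω φ) t x)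
        (P.Bop (P.Bop.adjoint (grad (incl P.T P.Ω v) t x + p))) := by
  rw [val_control, ← U_eq, ← U_eq]
  exact inner_feedback_eq P.Bop P.β_pos.ne' _ _ _

set_option maxHeartbeats 3000000 in
/-- Existence and uniqueness of the adjoint state, and strict differentiability of the cost. -/
theorem exists_adjointState_hasStrictFDerivAt {t₀ : ℝ} {y₀ : Euc d} {v : CtC2 P.T P.Ω}
    (ht₀ : t₀ ∈ Ioo 0 P.T) (hy₀ : y₀ ∈ P.ω) (hv : v ∈ P.D) :
    ∃ (p : ℝ → Euc d) (L : CtC1 P.T P.Ω ℝ →L[ℝ] ℝ),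
      P.IsAdjointState t₀ y₀ v p ∧
      (∀ p', P.IsAdjointState t₀ y₀ v p' → EqOn p' p (Icc t₀ P.T)) ∧
      (∀ φ : CtC1 P.T P.Ω ℝ, L φ = 1 / P.β * ∫ t in t₀..P.T,
        inner ℝ (grad φ t (P.Φ t₀ y₀ v t)) (P.Bop (P.Bop.adjoint
          (grad (incl P.T P.Ω v) t (P.Φ t₀ y₀ v t) + p t)))) ∧
      HasStrictFDerivAt (fun q : ℝ × Euc d × CtC2 P.T P.Ω => P.V q.1 q.2.1 q.2.2)
        (costDeriv (X := CtC2 P.T P.Ω) (p t₀) (val P.f t₀ y₀ + P.Bop (P.U v t₀ y₀))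
          (val P.ℓ t₀ y₀ + P.β / 2 * ‖P.U v t₀ y₀‖ ^ 2) (L.comp (incl P.T P.Ω))) (t₀, y₀, v) := by
  have ht₀' : t₀ ∈ Icc 0 P.T := Ioo_subset_Icc_self ht₀
  have hne : P.Ω.Nonempty := ⟨y₀, P.closure_ω_subset (subset_closure hy₀)⟩
  obtain ⟨Y, hY⟩ := exists_isFlow (X := CtC2 P.T P.Ω) P.convex_Ω hne P.f P.control
  have hsub₀ : Icc t₀ P.T ⊆ Icc 0 P.T := Icc_subset_Icc_left ht₀.1.le
  have hΦ : ∀ t ∈ Icc t₀ P.T, P.Φ t₀ y₀ v t = Y (t₀, y₀, v) t := fun t ht =>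
    Φ_eq hY ht₀' (hv.1 t₀ ht₀' y₀ hy₀) ht
  have hyc₀ := (hY.continuousOn (t₀, y₀, v) ht₀').mono hsub₀
  have hmem₀ := P.trajectory_mem ht₀ hy₀ hv hyc₀ hΦ
  obtain ⟨a, ha, hat, hmem⟩ := hY.exists_backward P.isOpen_Ω (q := (t₀, y₀, v)) ht₀ hmem₀
  have hat' : a < t₀ := hat
  have haT : a ≤ P.T := (hat'.trans ht₀.2).le
  have hS : Icc a P.T ⊆ Icc 0 P.T := Icc_subset_Icc_left ha
  have hat₀ : Icc t₀ P.T ⊆ Icc a P.T := Icc_subset_Icc_left hat'.le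
  have hyc := (hY.continuousOn (t₀, y₀, v) ht₀').mono hS
  have hyt₀ : Y (t₀, y₀, v) t₀ = y₀ := hY.initial _ ht₀'
  have hcl : ∀ t ∈ Icc a P.T, Y (t₀, y₀, v) t ∈ closure P.Ω := fun t ht =>
    subset_closure (hmem t ht)
  set y := Y (t₀, y₀, v) with hydef
  have hAc : ContinuousOn (fun t => dval (P.f + P.control v) t (y t)) (Icc a P.T) :=
    continuousOn_dval_comp _ hS hyc hcl
  -- The adjoint equation is solved on the larger interval `[a,T]`, since the strict derivative uses
  -- `p` at all initial times near `t₀`.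
  obtain ⟨p, hpT, hp⟩ := exists_hasDerivWithinAt_linear
    (A := fun t => -(dval (P.f + P.control v) t (y t)).adjoint)
    (c := adjointSource P.β P.ℓ (P.feedback v) y)
    (ContinuousLinearMap.adjoint.continuous.comp_continuousOn hAc).neg
    (continuousOn_adjointSource _ _ _ hS hyc hcl) (right_mem_Icc.2 haT)
    (-rieszSymm d (dval P.terminal P.T (y P.T)))
  have hp' : ∀ t ∈ Icc a P.T, HasDerivWithinAt p (adjointSource P.β P.ℓ (P.feedback v) y t
      - (dval (P.f + P.control v) t (y t)).adjoint (p t)) (Icc a P.T) t := fun t ht => by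
    have h := hp t ht
    rwa [neg_apply, neg_add_eq_sub] at h
  have hp₀ : ∀ t ∈ Icc t₀ P.T, HasDerivWithinAt p (adjointSource P.β P.ℓ (P.feedback v) y t
      - (dval (P.f + P.control v) t (y t)).adjoint (p t)) (Icc t₀ P.T) t := fun t ht =>
    (hp' t (hat₀ ht)).mono hat₀
  have hiff := fun p' : ℝ → Euc d =>
    isAdjointState_iff (p := p') ⟨ht₀.1.le, ht₀.2⟩ hyc₀ hΦ hmem₀
  have hpc : ContinuousOn p (Icc t₀ P.T) := fun t ht => (hp₀ t ht).continuousWithinAt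
  have hkc : ContinuousOn (fun t => P.Bop (P.Bop.adjoint
      (grad (incl P.T P.Ω v) t (y t) + p t))) (Icc t₀ P.T) :=
    P.Bop.continuous.comp_continuousOn (P.Bop.adjoint.continuous.comp_continuousOn
      (((rieszSymm d).continuous.comp_continuousOn
        (continuousOn_dval_comp (incl P.T P.Ω v) hsub₀ hyc₀
          fun t ht => subset_closure (hmem₀ t ht))).add hpc))
  obtain ⟨L, hL⟩ := exists_gradient_functional (Ω := P.Ω) ht₀.1.le ht₀.2.le hyc₀
    (fun t ht => subset_closure (hmem₀ t ht)) hkc (1 / P.β)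
  refine ⟨p, L, (hiff p).2 ⟨hp₀, hpT⟩, fun p' hp'' => ?_, fun φ => ?_, ?_⟩
  · obtain ⟨h1, h2⟩ := (hiff p').1 hp''
    exact adjoint_unique (fun t _ => norm_dval_le (P.f + P.control v) t (y t)) hp₀ h1
      (h2.trans hpT.symm)
  · rw [hL]
    congr 1
    refine intervalIntegral.integral_congr fun t ht => ?_
    rw [uIcc_of_le ht₀.2.le] at ht
    simp only [hΦ t ht]
  · have hLx : ∀ φ : CtC2 P.T P.Ω, L.comp (incl P.T P.Ω) φ = ∫ t in t₀..P.T,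
        (P.β * inner ℝ (val (P.feedback v) t (y t)) (val (P.feedback φ) t (y t))
          - inner ℝ (p t) (val (P.control φ) t (y t))) := fun φ => by
      rw [ContinuousLinearMap.comp_apply, hL, ← intervalIntegral.integral_const_mul]
      exact intervalIntegral.integral_congr fun t _ => (inner_control_eq v φ t (y t) (p t)).symm
    have hcost := hY.hasStrictFDerivAt_cost P.isOpen_Ω P.convex_Ω P.isBounded_Ω P.β_pos P.ℓ
      P.terminal P.feedback (q₀ := (t₀, y₀, v)) ha ⟨hat', ht₀.2⟩ hmem hp' hpT hLx
    -- The agreement holds on a full neighbourhood in the product space: a curve of the flow that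
    -- stays in `Ω` is a trajectory, whether or not its parameter is in `𝒟`.
    have hV : (fun q : ℝ × Euc d × CtC2 P.T P.Ω => (∫ t in q.1..P.T,
        (val P.ℓ t (Y q t) + P.β / 2 * ‖val (P.feedback q.2.2) t (Y q t)‖ ^ 2))
          + val P.terminal P.T (Y q P.T)) =ᶠ[𝓝 (t₀, y₀, v)] fun q => P.V q.1 q.2.1 q.2.2 := by
      have htime : ∀ᶠ q : ℝ × Euc d × CtC2 P.T P.Ω in 𝓝 (t₀, y₀, v), q.1 ∈ Ioo a P.T :=
        continuousAt_fst.eventually (Ioo_mem_nhds hat' ht₀.2)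
      filter_upwards [hY.eventually_mem P.isOpen_Ω ha ⟨hat', ht₀.2⟩ hmem, htime] with q hq hqt
      have hq0 : q.1 ∈ Icc 0 P.T := hS (Ioo_subset_Icc_self hqt)
      have hsub : ∀ t ∈ Icc q.1 P.T, Y q t ∈ closure P.Ω := fun t ht =>
        subset_closure (hq t ⟨hqt.1.le.trans ht.1, ht.2⟩)
      exact (V_eq hq0 fun t ht => Φ_eq hY hq0 ⟨_, isTrajectory_of_isFlow hY hq0 hsub⟩ ht).symm
    have h := hcost.congr_of_eventuallyEq hV
    simp only [← hydef, hyt₀, val_add, val_control, ← U_eq] at h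
    exact h

end ControlProblem

/-! ### Partial derivatives read off from the total derivative. -/

section Partial

variable {E X : Type*} [NormedAddCommGroup E] [InnerProductSpace ℝ E]
  [NormedAddCommGroup X] [NormedSpace ℝ X] {f : ℝ × E × X → ℝ} {p F : E} {h : ℝ} {Lx : X →L[ℝ] ℝ}
  {t : ℝ} {y : E} {v : X}

theorem hasGradientAt_of_costDeriv [CompleteSpace E]
    (hf : HasFDerivAt f (costDeriv p F h Lx) (t, y, v)) :
    HasGradientAt (fun z => f (t, z, v)) (-p) y := by
  rw [hasGradientAt_iff_hasFDerivAt]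
  refine (HasFDerivAt.comp (f := fun z : E => (t, z, v)) y hf ((hasFDerivAt_const t y).prodMk
    ((hasFDerivAt_id y).prodMk (hasFDerivAt_const v y)))).congr_fderiv ?_
  ext e
  simp [costDeriv_apply]

theorem hasDerivAt_of_costDeriv (hf : HasFDerivAt f (costDeriv p F h Lx) (t, y, v)) :
    HasDerivAt (fun s => f (s, y, v)) (-h + inner ℝ p F) t := by
  have h1 := HasFDerivAt.comp_hasDerivAt (f := fun s : ℝ => (s, y, v)) t hf
    ((hasDerivAt_id t).prodMk ((hasDerivAt_const t y).prodMk (hasDerivAt_const t v)))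
  simpa [costDeriv_apply, Function.comp_def] using h1

theorem hasFDerivAt_of_costDeriv (hf : HasFDerivAt f (costDeriv p F h Lx) (t, y, v)) :
    HasFDerivAt (fun w => f (t, y, w)) Lx v := by
  refine (HasFDerivAt.comp (f := fun w : X => (t, y, w)) v hf ((hasFDerivAt_const t v).prodMk
    ((hasFDerivAt_const y v).prodMk (hasFDerivAt_id v)))).congr_fderiv ?_
  ext e
  simp [costDeriv_apply]

end Partial

/-- A functional on `C([0,T]; C¹(Ω̄))` is determined by its restriction to `C([0,T]; C²(Ω̄))`. -/
theorem eq_of_comp_incl_eq {d : ℕ} {Ω : Set (Euc d)} (hΩ : IsOpen Ω) (hconv : Convex ℝ Ω)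
    (hbd : Bornology.IsBounded Ω) (hne : Ω.Nonempty) (T : ℝ) {L L' : CtC1 T Ω ℝ →L[ℝ] ℝ}
    (h : L'.comp (incl T Ω) = L.comp (incl T Ω)) : L' = L :=
  DFunLike.coe_injective ((denseRange_incl hΩ hconv hbd hne T).equalizer L'.continuous L.continuous
    (congrArg DFunLike.coe h))

end FeedbackLearning

end

/-! ### The proposition. -/

set_option maxHeartbeats 3000000 in
theorem mainTheorem3 {d M : ℕ} (P : FeedbackLearning.ControlProblem d M) :
    -- `𝒱` is continuously (Fréchet) differentiable on `(0,T) × ω × 𝒟`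
    ((∀ q ∈ Ioo 0 P.T ×ˢ P.ω ×ˢ P.D,
        DifferentiableAt ℝ
          (fun q : ℝ × FeedbackLearning.Euc d × FeedbackLearning.CtC2 P.T P.Ω =>
            P.V q.1 q.2.1 q.2.2) q) ∧
      ContinuousOn
        (fderiv ℝ (fun q : ℝ × FeedbackLearning.Euc d × FeedbackLearning.CtC2 P.T P.Ω =>
          P.V q.1 q.2.1 q.2.2))
        (Ioo 0 P.T ×ˢ P.ω ×ˢ P.D)) ∧
    ∀ t₀ ∈ Ioo 0 P.T, ∀ y₀ ∈ P.ω, ∀ v ∈ P.D,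
      -- the adjoint equation has exactly one solution `p` on `[t₀,T]`
      ∃ p : ℝ → FeedbackLearning.Euc d, P.IsAdjointState t₀ y₀ v p ∧
        (∀ p', P.IsAdjointState t₀ y₀ v p' → EqOn p' p (Icc t₀ P.T)) ∧
        HasGradientAt (fun y => P.V t₀ y v) (-p t₀) y₀ ∧
        HasDerivAt (fun t => P.V t y₀ v)
          (-FeedbackLearning.val P.ℓ t₀ y₀ - P.β / 2 * ‖P.U v t₀ y₀‖ ^ 2
            + inner ℝ (p t₀) (FeedbackLearning.val P.f t₀ y₀ + P.Bop (P.U v t₀ y₀))) t₀ ∧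
        -- `D_v 𝒱` extends uniquely to a bounded linear functional `L` on `C([0,T]; C¹(Ω̄))`
        ∃ L : FeedbackLearning.CtC1 P.T P.Ω ℝ →L[ℝ] ℝ,
          HasFDerivAt (fun w => P.V t₀ y₀ w) (L.comp (FeedbackLearning.incl P.T P.Ω)) v ∧
          (∀ L' : FeedbackLearning.CtC1 P.T P.Ω ℝ →L[ℝ] ℝ,
            L'.comp (FeedbackLearning.incl P.T P.Ω) = L.comp (FeedbackLearning.incl P.T P.Ω) →
              L' = L) ∧
          ∀ φ : FeedbackLearning.CtC1 P.T P.Ω ℝ,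
            L φ = 1 / P.β * ∫ t in t₀..P.T,
              inner ℝ (FeedbackLearning.grad φ t (P.Φ t₀ y₀ v t))
                (P.Bop (P.Bop.adjoint
                  (FeedbackLearning.grad (FeedbackLearning.incl P.T P.Ω v) t (P.Φ t₀ y₀ v t)
                    + p t))) := by
  have hstrict : ∀ q ∈ Ioo 0 P.T ×ˢ P.ω ×ˢ P.D, ∃ f' : ℝ × FeedbackLearning.Euc d ×
      FeedbackLearning.CtC2 P.T P.Ω →L[ℝ] ℝ, HasStrictFDerivAt
        (fun q : ℝ × FeedbackLearning.Euc d × FeedbackLearning.CtC2 P.T P.Ω =>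
          P.V q.1 q.2.1 q.2.2) f' q := fun q hq => by
    obtain ⟨_, _, _, _, _, hL⟩ :=
      FeedbackLearning.ControlProblem.exists_adjointState_hasStrictFDerivAt hq.1 hq.2.1 hq.2.2
    exact ⟨_, hL⟩
  have hcont := FeedbackLearning.continuousOn_fderiv_of_hasStrictFDerivAt
    (Q := ℝ × FeedbackLearning.Euc d × FeedbackLearning.CtC2 P.T P.Ω) (W := ℝ)
    (S := Ioo 0 P.T ×ˢ P.ω ×ˢ P.D) hstrict
  refine ⟨⟨fun q hq => ?_,
    hcont⟩, ?_⟩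
  · obtain ⟨f', hf'⟩ := hstrict q hq
    exact hf'.hasFDerivAt.differentiableAt
  intro t₀ ht₀ y₀ hy₀ v hv
  obtain ⟨p, L, hp, huniq, hLφ, hL⟩ :=
    FeedbackLearning.ControlProblem.exists_adjointState_hasStrictFDerivAt ht₀ hy₀ hv
  have hne : P.Ω.Nonempty := ⟨y₀, P.closure_ω_subset (subset_closure hy₀)⟩
  have hF := hL.hasFDerivAt
  refine ⟨p, hp, huniq, FeedbackLearning.hasGradientAt_of_costDeriv
      (X := FeedbackLearning.CtC2 P.T P.Ω) hF, ?_, L,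
    FeedbackLearning.hasFDerivAt_of_costDeriv (X := FeedbackLearning.CtC2 P.T P.Ω) hF,
    fun L' hL' =>
      FeedbackLearning.eq_of_comp_incl_eq P.isOpen_Ω P.convex_Ω P.isBounded_Ω hne P.T hL',
    hLφ⟩
  have ht := FeedbackLearning.hasDerivAt_of_costDeriv (X := FeedbackLearning.CtC2 P.T P.Ω) hF
  rwa [neg_add'] at ht
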